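/- Let $\Gamma=\{(\xi_1,\xi_2)\in\mathbb R^2:\xi_1+\xi_2=0\}$, and let $\mathcal M_\Gamma(\mathbb R^2)$ be the class of functions $m:\mathbb R^2\to\mathbb C$, smooth off $\Gamma$, such that for every multi-index $\vec\alpha\in(\mathbb N\cup\{0\})^2$ there is a constant $C_{\vec\alpha}$ with $$|\partial^{\vec\alpha}m(\vec\xi)|\le \frac{C_{\vec\alpha}}{\operatorname{dist}(\vec\xi,\Gamma)^{|\vec\alpha|}}\qquad\text{for all }\vec\xi\in\mathbb R^2,$$ where for $\vec\xi\in\Gamma$ the right-hand side is read as $+\infty$ if $\vec\alpha\neq 0$ and as $C_0$ if $\vec\alpha=0$. Then there exists a single $m\in\mathcal M_\Gamma(\mathbb R^2)$ such that the bilinear multiplier defined for Schwartz functions $f_1,f_2\in\mathcal S(\mathbb R)$ by $$T_m(f_1,f_2)(x)=\int_{\mathbb R^2}m(\xi_1,\xi_2)\,\hat f_1(\xi_1)\,\hat f_2(\xi_2)\,e^{2\pi i x(\xi_1+\xi_2)}\,d\xi_1\,d\xi_2,\qquad \hat f(\xi)=\int_{\mathbb R} f(x)e^{-2\pi i x\xi}\,dx,$$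 satisfies no $L^p$ estimates: for all $p_1,p_2\in[1,\infty]$, with $r\in[1/2,\infty]$ given by $\frac1r=\frac1{p_1}+\frac1{p_2}$, there is no finite constant $C$ such that $$\|T_m(f_1,f_2)\|_{L^r(\mathbb R)}\le C\,\|f_1\|_{L^{p_1}(\mathbb R)}\,\|f_2\|_{L^{p_2}(\mathbb R)}\qquad\text{for all } f_1,f_2\in\mathcal S(\mathbb R).$$ -/

import Mathlib

open MeasureTheory
open scoped ENNReal NNReal FourierTransform SchwartzMap ContDiff

noncomputable section

/-- The frequency plane `ℝ²` with its Euclidean metric; coordinates are `ξ 0` and `ξ 1`. -/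
abbrev FreqPlane : Type := EuclideanSpace ℝ (Fin 2)

/-- The degenerate line `Γ = {ξ₁ + ξ₂ = 0}`. -/
def degenerateLine : Set FreqPlane := {ξ | ξ 0 + ξ 1 = 0}

/-- The partial derivative `∂_i m`. -/
def partialDeriv (i : Fin 2) (m : FreqPlane → ℂ) : FreqPlane → ℂ :=
  fun ξ => lineDeriv ℝ m ξ (EuclideanSpace.single i (1 : ℝ))

/-- The iterated partial derivative `∂^α m = ∂_0^{α 0} ∂_1^{α 1} m`, for a multi-index `α`. -/
def multiDeriv (α : Fin 2 → ℕ) (m : FreqPlane → ℂ) : FreqPlane → ℂ :=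
  (partialDeriv 0)^[α 0] ((partialDeriv 1)^[α 1] m)

/-- The Hörmander–Mikhlin class adapted to `Γ`, with derivatives up to order `M`:
`m` is `C^M` off `Γ`, and `|∂^α m(ξ)| ≤ C_α / dist(ξ, Γ)^{|α|}` whenever `|α| ≤ M`.
The bound is written multiplied out; thus on `Γ` it says nothing for `α ≠ 0`
(where the right-hand side is `+∞`), and for `α = 0` it says that `m` is bounded on `ℝ²`. -/
def MultiplierClass (M : ℕ) : Set (FreqPlane → ℂ) :=
  {m | ContDiffOn ℝ M m degenerateLineᶜ ∧
    ∀ α : Fin 2 → ℕ, α 0 + α 1 ≤ M → ∃ C : ℝ, ∀ ξ : FreqPlane,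
      Metric.infDist ξ degenerateLine ^ (α 0 + α 1) * ‖multiDeriv α m ξ‖ ≤ C}

/-- The bilinear multiplier
`T_m(f₁, f₂)(x) = ∫ m(ξ₁, ξ₂) f̂₁(ξ₁) f̂₂(ξ₂) e^{2πi x (ξ₁ + ξ₂)} dξ₁ dξ₂` on Schwartz functions,
where `f̂(ξ) = ∫ f(x) e^{-2πi x ξ} dx`. -/
def bilinearMultiplier (m : FreqPlane → ℂ) (f₁ f₂ : 𝓢(ℝ, ℂ)) : ℝ → ℂ :=
  fun x => ∫ ξ : FreqPlane,
    m ξ * 𝓕 (f₁ : ℝ → ℂ) (ξ 0) * 𝓕 (f₂ : ℝ → ℂ) (ξ 1) *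
      Complex.exp (((2 * Real.pi * x * (ξ 0 + ξ 1) : ℝ) : ℂ) * Complex.I)

/-- The Hölder-type estimate `L^{p₁} × L^{p₂} → L^r`, `1/r = 1/p₁ + 1/p₂`, for an operator
defined on pairs of Schwartz functions. -/
def SatisfiesLpEstimate (T : 𝓢(ℝ, ℂ) → 𝓢(ℝ, ℂ) → ℝ → ℂ) (p₁ p₂ : ℝ≥0∞) : Prop :=
  ∃ C : ℝ≥0, ∀ f₁ f₂ : 𝓢(ℝ, ℂ),
    eLpNorm (T f₁ f₂) (p₁⁻¹ + p₂⁻¹)⁻¹ volume ≤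
      (C : ℝ≥0∞) * eLpNorm (f₁ : ℝ → ℂ) p₁ volume * eLpNorm (f₂ : ℝ → ℂ) p₂ volume

end

/-! The symbol is `lacunarySum phaseCoeff φ φ`. Where ξ₁ ≈ 8^t it is, up to a cutoff in ξ₁, a
function of η = ξ₁ + ξ₂ alone, namely ∑ c(t,k) φ(η / 8^k) over k ≤ t. The coefficients have modulus
at most 1 and may be prescribed separately for each t. They do not harm the symbol estimates: at
each point at most one term survives, and each derivative brings a factor of at most 8^(-k),
comparable to 1/η.

This freedom in t defeats every bound. Let f₁ consist of packets at the points j/J, 0 ≤ j < J,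
modulated to frequencies 8^(t_j), and f₂ of wider packets modulated to -8^(t_j), where c(t_j,k) =
e^{2πi 8^k j/J} for 1 ≤ k ≤ n. As the t_j run off to infinity the cross terms die
(`tendsto_bilinearMultiplier`, `tendsto_lacunarySum_phaseCoeff`), leaving the sum over k of
smoothing at scale 8^(-k) applied to a step approximation of e^{2πi 8^k x} on (0, 1]. Letting J → ∞
gives a function that differs by O(1) on [1/4, 3/4] from ∑ e^{2πi 8^k x}, 1 ≤ k ≤ n
(`dilateSum_indicator_sub_le`).

The inputs stay bounded with fixed compact support, so all their L^p norms are bounded, and Fatou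
carries an assumed estimate through both limits. But the lacunary sum has L² norm of order √n and L⁴
norm O(√n), hence unbounded L^{1/2} norm (`exists_lt_eLpNorm_lacunaryOsc`), and on [1/4, 3/4] the
L^r norm dominates the L^{1/2} norm because r ≥ 1/2. One symbol serves all n and J, since t encodes
each (n, j, J) infinitely often. -/

/-! ### Bumps at separated scales -/

/-- A smooth function supported in `[1/2, 3/2]`. -/
structure IsUnitBump (g : ℝ → ℂ) : Prop where
  smooth : ContDiff ℝ ∞ g
  tsupport_subset : tsupport g ⊆ Set.Icc (1 / 2) (3 / 2)

namespace IsUnitBump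

variable {g : ℝ → ℂ}

theorem mem_Icc (hg : IsUnitBump g) {x : ℝ} (hx : g x ≠ 0) : x ∈ Set.Icc (1 / 2 : ℝ) (3 / 2) :=
  hg.tsupport_subset (subset_tsupport g hx)

theorem deriv (hg : IsUnitBump g) : IsUnitBump (deriv g) :=
  ⟨(contDiff_infty_iff_deriv.1 hg.smooth).2, tsupport_deriv_subset.trans hg.tsupport_subset⟩

theorem differentiable (hg : IsUnitBump g) : Differentiable ℝ g :=
  (contDiff_infty_iff_deriv.1 hg.smooth).1

theorem hasCompactSupport (hg : IsUnitBump g) : HasCompactSupport g :=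
  isCompact_Icc.of_isClosed_subset (isClosed_tsupport g) hg.tsupport_subset

theorem exists_bound (hg : IsUnitBump g) : ∃ B : ℝ, 0 ≤ B ∧ ∀ x, ‖g x‖ ≤ B := by
  obtain ⟨B, hB⟩ := hg.hasCompactSupport.exists_bound_of_continuous hg.smooth.continuous
  exact ⟨B, (norm_nonneg _).trans (hB 0), hB⟩

theorem hasDerivAt_comp (hg : IsUnitBump g) (a s r : ℝ) :
    HasDerivAt (fun s => g ((a + s) / r)) (_root_.deriv g ((a + s) / r) / r) s := by
  have h1 : HasDerivAt (fun s : ℝ => (a + s) / r) (1 / r) s :=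
    ((hasDerivAt_id s).const_add a).div_const r
  have h2 := (hg.differentiable ((a + s) / r)).hasDerivAt.scomp s h1
  refine h2.congr_deriv ?_
  rw [Complex.real_smul]
  push_cast
  ring

/-- The scale of a dilated bump which does not vanish at a given point is determined. -/
theorem scale_unique (hg : IsUnitBump g) {x : ℝ} {t u : ℕ} (ht : g (x / 8 ^ t) ≠ 0)
    (hu : g (x / 8 ^ u) ≠ 0) : t = u := by
  have key : ∀ a b : ℕ, g (x / 8 ^ a) ≠ 0 → g (x / 8 ^ b) ≠ 0 → ¬ a < b := by
    intro a b ha hb hab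
    have h1 := (hg.mem_Icc ha).2
    have h2 := (hg.mem_Icc hb).1
    have pa : (0 : ℝ) < 8 ^ a := by positivity
    have pb : (0 : ℝ) < 8 ^ b := by positivity
    rw [div_le_iff₀ pa] at h1
    rw [le_div_iff₀ pb] at h2
    -- The dilated supports are disjoint because 3/2 · 8^a < 1/2 · 8^(a+1).
    have h3 : (8 : ℝ) ^ (a + 1) ≤ 8 ^ b := pow_le_pow_right₀ (by norm_num) hab
    rw [pow_succ] at h3
    linarith
  have h1 := key t u ht hu
  have h2 := key u t hu ht
  omega

end IsUnitBump

/-- If at most one term of a finite sum is nonzero, the sum obeys the bound for single terms. -/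
theorem norm_sum_le_of_unique {ι : Type*} {s : Finset ι} {f : ι → ℂ} {B : ℝ} (hB : 0 ≤ B)
    (hf : ∀ i ∈ s, ‖f i‖ ≤ B) (hu : ∀ i ∈ s, ∀ j ∈ s, f i ≠ 0 → f j ≠ 0 → i = j) :
    ‖∑ i ∈ s, f i‖ ≤ B := by
  by_cases h : ∃ i ∈ s, f i ≠ 0
  · obtain ⟨i, hi, hfi⟩ := h
    rw [Finset.sum_eq_single_of_mem i hi fun j hj hji => by
      by_contra hfj
      exact hji (hu j hj i hi hfj hfi)]
    exact hf i hi
  · push Not at h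
    rw [Finset.sum_eq_zero h, norm_zero]
    exact hB

/-! ### Lacunary symbols and their derivatives -/

/-- The sum `∑_t ∑_{k ≤ t} c t k * g (ξ₁ / 8 ^ t) * h ((ξ₁ + ξ₂) / 8 ^ k)`. -/
noncomputable def lacunarySum (c : ℕ → ℕ → ℂ) (g h : ℝ → ℂ) : FreqPlane → ℂ := fun ξ =>
  ∑' t : ℕ, ∑ k ∈ Finset.range (t + 1), c t k * g (ξ 0 / 8 ^ t) * h ((ξ 0 + ξ 1) / 8 ^ k)

section lacunarySum

variable {c : ℕ → ℕ → ℂ} {g h : ℝ → ℂ}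

/-- A term of index t needs ξ₁ ≥ 8^t / 2, so the sum is locally finite and can be differentiated
term by term. -/
theorem lacunarySum_eq_sum (hg : IsUnitBump g) {T : ℕ} {ξ : FreqPlane} (hξ : ξ 0 < 8 ^ T / 2) :
    lacunarySum c g h ξ = ∑ t ∈ Finset.range T, ∑ k ∈ Finset.range (t + 1),
      c t k * g (ξ 0 / 8 ^ t) * h ((ξ 0 + ξ 1) / 8 ^ k) := by
  refine tsum_eq_sum fun t ht => Finset.sum_eq_zero fun k _ => ?_
  have h0 : g (ξ 0 / 8 ^ t) = 0 := by
    by_contra hne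
    have h1 := (hg.mem_Icc hne).1
    rw [le_div_iff₀ (by positivity)] at h1
    have h2 : (8 : ℝ) ^ T ≤ 8 ^ t :=
      pow_le_pow_right₀ (by norm_num) (by simpa using ht)
    linarith
  rw [h0, mul_zero, zero_mul]

theorem exists_lt_eight_pow (R : ℝ) : ∃ T : ℕ, R < 8 ^ T / 2 := by
  obtain ⟨T, hT⟩ := pow_unbounded_of_one_lt (2 * R) (by norm_num : (1 : ℝ) < 8)
  exact ⟨T, by linarith⟩

theorem lacunarySum_contDiff (hg : IsUnitBump g) (hh : IsUnitBump h) :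
    ContDiff ℝ ∞ (lacunarySum c g h) := by
  rw [contDiff_iff_contDiffAt]
  intro ξ
  obtain ⟨T, hT⟩ := exists_lt_eight_pow (ξ 0)
  have hc : Continuous fun ζ : FreqPlane => ζ 0 := by fun_prop
  have hev : lacunarySum c g h =ᶠ[nhds ξ] fun ζ => ∑ t ∈ Finset.range T,
      ∑ k ∈ Finset.range (t + 1), c t k * g (ζ 0 / 8 ^ t) * h ((ζ 0 + ζ 1) / 8 ^ k) := by
    filter_upwards [hc.continuousAt.eventually (gt_mem_nhds hT)] with ζ hζ
    exact lacunarySum_eq_sum hg hζ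
  refine ContDiffAt.congr_of_eventuallyEq (ContDiff.contDiffAt ?_) hev
  have c0 : ContDiff ℝ ∞ fun ζ : FreqPlane => ζ 0 := by fun_prop
  have c1 : ContDiff ℝ ∞ fun ζ : FreqPlane => ζ 1 := by fun_prop
  refine ContDiff.sum fun t _ => ContDiff.sum fun k _ => ?_
  exact (contDiff_const.mul (hg.smooth.comp (c0.div_const _))).mul
    (hh.smooth.comp ((c0.add c1).div_const _))

theorem lacunarySum_partialDeriv_one (hg : IsUnitBump g) (hh : IsUnitBump h) :
    partialDeriv 1 (lacunarySum c g h) =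
      lacunarySum (fun t k => c t k / 8 ^ k) g (deriv h) := by
  ext ξ
  obtain ⟨T, hT⟩ := exists_lt_eight_pow (ξ 0)
  have hev : (fun s : ℝ => lacunarySum c g h (ξ + s • EuclideanSpace.single 1 1)) = fun s =>
      ∑ t ∈ Finset.range T, ∑ k ∈ Finset.range (t + 1),
        c t k * g (ξ 0 / 8 ^ t) * h ((ξ 0 + ξ 1 + s) / 8 ^ k) := by
    ext s
    rw [lacunarySum_eq_sum hg (by simpa using hT)]
    simp [add_assoc]
  rw [partialDeriv, lineDeriv, hev, lacunarySum_eq_sum hg hT]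
  refine HasDerivAt.deriv (HasDerivAt.fun_sum fun t _ => HasDerivAt.fun_sum fun k _ => ?_)
  refine ((hh.hasDerivAt_comp (ξ 0 + ξ 1) 0 (8 ^ k)).const_mul _).congr_deriv ?_
  simp only [add_zero]
  push_cast
  ring

theorem lacunarySum_partialDeriv_zero (hg : IsUnitBump g) (hh : IsUnitBump h) :
    partialDeriv 0 (lacunarySum c g h) =
      lacunarySum (fun t k => c t k / 8 ^ t) (deriv g) h +
        lacunarySum (fun t k => c t k / 8 ^ k) g (deriv h) := by
  ext ξ
  -- The margin 1 lets the same T serve every shift s < 1, since this derivative moves ξ₁.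
  obtain ⟨T, hT⟩ := exists_lt_eight_pow (ξ 0 + 1)
  have hev : (fun s : ℝ => lacunarySum c g h (ξ + s • EuclideanSpace.single 0 1)) =ᶠ[nhds 0]
      fun s => ∑ t ∈ Finset.range T, ∑ k ∈ Finset.range (t + 1),
        c t k * (g ((ξ 0 + s) / 8 ^ t) * h ((ξ 0 + ξ 1 + s) / 8 ^ k)) := by
    filter_upwards [gt_mem_nhds (zero_lt_one' ℝ)] with s hs
    rw [lacunarySum_eq_sum hg (T := T) (by simpa using by linarith)]
    simp [add_right_comm, mul_assoc]
  rw [partialDeriv, lineDeriv, hev.deriv_eq, Pi.add_apply,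
    lacunarySum_eq_sum hg.deriv (T := T) (by linarith),
    lacunarySum_eq_sum hg (T := T) (by linarith), ← Finset.sum_add_distrib]
  simp_rw [← Finset.sum_add_distrib]
  refine HasDerivAt.deriv (HasDerivAt.fun_sum fun t _ => HasDerivAt.fun_sum fun k _ => ?_)
  refine (((hg.hasDerivAt_comp (ξ 0) 0 (8 ^ t)).mul
    (hh.hasDerivAt_comp (ξ 0 + ξ 1) 0 (8 ^ k))).const_mul _).congr_deriv ?_
  simp only [add_zero]
  push_cast
  ring

/-- At a given point only one pair (t, k) survives. There |ξ₁ + ξ₂| ≤ 3/2 · 8^k, so the decay of the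
coefficient pays for the N powers. -/
theorem lacunarySum_bound (hg : IsUnitBump g) (hh : IsUnitBump h) {N : ℕ} {C : ℝ}
    (hc : ∀ t k, k ≤ t → ‖c t k‖ * 8 ^ (k * N) ≤ C) :
    ∃ B : ℝ, ∀ ξ : FreqPlane, |ξ 0 + ξ 1| ^ N * ‖lacunarySum c g h ξ‖ ≤ B := by
  obtain ⟨G, hG0, hG⟩ := hg.exists_bound
  obtain ⟨H, hH0, hH⟩ := hh.exists_bound
  have hC0 : 0 ≤ C := (by positivity : (0 : ℝ) ≤ ‖c 0 0‖ * 8 ^ (0 * N)).trans (hc 0 0 le_rfl)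
  refine ⟨(3 / 2) ^ N * C * G * H, fun ξ => ?_⟩
  obtain ⟨T, hT⟩ := exists_lt_eight_pow (ξ 0)
  rw [lacunarySum_eq_sum hg hT, ← abs_pow, ← Real.norm_eq_abs, ← Complex.norm_real, ← norm_mul,
    Finset.mul_sum]
  have hB0 : 0 ≤ (3 / 2) ^ N * C * G * H := by positivity
  refine norm_sum_le_of_unique hB0 (fun t _ => ?_) ?_
  · rw [Finset.mul_sum]
    refine norm_sum_le_of_unique hB0 (fun k hk => ?_) ?_
    · by_cases h0 : h ((ξ 0 + ξ 1) / 8 ^ k) = 0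
      · simpa [h0] using hB0
      have hm := hh.mem_Icc h0
      have p8 : (0 : ℝ) < 8 ^ k := by positivity
      rw [Set.mem_Icc, div_le_iff₀ p8, le_div_iff₀ p8] at hm
      have hη : |ξ 0 + ξ 1| ≤ 3 / 2 * 8 ^ k := abs_le.2 ⟨by linarith, hm.2⟩
      have hηN : |ξ 0 + ξ 1| ^ N ≤ (3 / 2) ^ N * 8 ^ (k * N) := by
        rw [pow_mul, ← mul_pow]
        exact pow_le_pow_left₀ (abs_nonneg _) hη N
      simp only [norm_mul, Complex.norm_real, norm_pow, Real.norm_eq_abs]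
      have hck := hc t k (by simpa [Nat.lt_succ_iff] using hk)
      calc |ξ 0 + ξ 1| ^ N * (‖c t k‖ * ‖g (ξ 0 / 8 ^ t)‖ * ‖h ((ξ 0 + ξ 1) / 8 ^ k)‖)
          ≤ ((3 / 2) ^ N * 8 ^ (k * N)) * (‖c t k‖ * G * H) := by
            gcongr
            · exact hG _
            · exact hH _
        _ = (3 / 2) ^ N * (‖c t k‖ * 8 ^ (k * N)) * G * H := by ring
        _ ≤ _ := by gcongr
    · intro i _ j _ hi hj
      exact hh.scale_unique (right_ne_zero_of_mul (right_ne_zero_of_mul hi))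
        (right_ne_zero_of_mul (right_ne_zero_of_mul hj))
  · intro i _ j _ hi hj
    have hne : ∀ t, ((((ξ 0 + ξ 1) ^ N : ℝ)) : ℂ) * ∑ k ∈ Finset.range (t + 1),
        c t k * g (ξ 0 / 8 ^ t) * h ((ξ 0 + ξ 1) / 8 ^ k) ≠ 0 → g (ξ 0 / 8 ^ t) ≠ 0 := by
      intro t ht h0
      simp [h0] at ht
    exact hg.scale_unique (hne i hi) (hne j hj)

end lacunarySum

/-! ### Membership in the multiplier class -/

/-- Finite sums of functions `lacunarySum c g h` whose coefficients decay like `8 ^ (-k * N)`. -/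
inductive IsLacunarySymbol : ℕ → (FreqPlane → ℂ) → Prop
  | lacunarySum {N : ℕ} {c : ℕ → ℕ → ℂ} {g h : ℝ → ℂ} {C : ℝ} (hg : IsUnitBump g)
      (hh : IsUnitBump h) (hc : ∀ t k, k ≤ t → ‖c t k‖ * 8 ^ (k * N) ≤ C) :
      IsLacunarySymbol N (lacunarySum c g h)
  | add {N : ℕ} {f₁ f₂ : FreqPlane → ℂ} (h₁ : IsLacunarySymbol N f₁)
      (h₂ : IsLacunarySymbol N f₂) : IsLacunarySymbol N (f₁ + f₂)

namespace IsLacunarySymbol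

variable {N : ℕ} {f : FreqPlane → ℂ}

theorem contDiff (hf : IsLacunarySymbol N f) : ContDiff ℝ ∞ f := by
  induction hf with
  | lacunarySum hg hh _ => exact lacunarySum_contDiff hg hh
  | add _ _ h₁ h₂ => exact h₁.add h₂

theorem bound (hf : IsLacunarySymbol N f) :
    ∃ B : ℝ, ∀ ξ : FreqPlane, |ξ 0 + ξ 1| ^ N * ‖f ξ‖ ≤ B := by
  induction hf with
  | lacunarySum hg hh hc => exact lacunarySum_bound hg hh hc
  | add _ _ h₁ h₂ =>
    obtain ⟨B₁, hB₁⟩ := h₁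
    obtain ⟨B₂, hB₂⟩ := h₂
    refine ⟨B₁ + B₂, fun ξ => (mul_le_mul_of_nonneg_left (norm_add_le _ _)
      (by positivity)).trans ?_⟩
    rw [mul_add]
    exact add_le_add (hB₁ ξ) (hB₂ ξ)

theorem partialDeriv_add {i : Fin 2} {f₁ f₂ : FreqPlane → ℂ} (h₁ : ContDiff ℝ ∞ f₁)
    (h₂ : ContDiff ℝ ∞ f₂) :
    partialDeriv i (f₁ + f₂) = partialDeriv i f₁ + partialDeriv i f₂ := by
  ext ξ
  have d₁ : LineDifferentiableAt ℝ f₁ ξ (EuclideanSpace.single i (1 : ℝ)) :=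
    (h₁.differentiable (by simp) ξ).lineDifferentiableAt
  have d₂ : LineDifferentiableAt ℝ f₂ ξ (EuclideanSpace.single i (1 : ℝ)) :=
    (h₂.differentiable (by simp) ξ).lineDifferentiableAt
  exact HasDerivAt.deriv (HasDerivAt.add d₁.hasLineDerivAt d₂.hasLineDerivAt)

/-- Differentiating h gains 8^(-k), differentiating g gains 8^(-t). The truncation k ≤ t of the
symbol is there to make the second gain at least as good as the first. -/
theorem coeff_div {c : ℕ → ℕ → ℂ} {C : ℝ} (hc : ∀ t k, k ≤ t → ‖c t k‖ * 8 ^ (k * N) ≤ C)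
    {e : ℕ → ℕ → ℕ} (he : ∀ t k, k ≤ t → k ≤ e t k) :
    ∀ t k, k ≤ t → ‖c t k / 8 ^ e t k‖ * 8 ^ (k * (N + 1)) ≤ C := by
  intro t k hk
  refine le_trans ?_ (hc t k hk)
  have h8 : (8 : ℝ) ^ k ≤ 8 ^ e t k := pow_le_pow_right₀ (by norm_num) (he t k hk)
  have hn : ‖(8 : ℂ)‖ = 8 := by simp
  rw [norm_div, norm_pow, hn, mul_add, mul_one, pow_add, div_mul_eq_mul_div,
    div_le_iff₀ (by positivity), ← mul_assoc]
  gcongr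

theorem partialDeriv (hf : IsLacunarySymbol N f) (i : Fin 2) :
    IsLacunarySymbol (N + 1) (partialDeriv i f) := by
  induction hf with
  | lacunarySum hg hh hc =>
    fin_cases i
    · simp only [Fin.zero_eta, lacunarySum_partialDeriv_zero hg hh]
      exact .add (.lacunarySum hg.deriv hh (coeff_div (e := fun t _ => t) hc fun _ _ h => h))
        (.lacunarySum hg hh.deriv (coeff_div (e := fun _ k => k) hc fun _ _ _ => le_rfl))
    · simp only [Fin.mk_one, lacunarySum_partialDeriv_one hg hh]
      exact .lacunarySum hg hh.deriv (coeff_div (e := fun _ k => k) hc fun _ _ _ => le_rfl)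
  | add h₁ h₂ ih₁ ih₂ =>
    rw [partialDeriv_add h₁.contDiff h₂.contDiff]
    exact .add ih₁ ih₂

theorem iterate_partialDeriv (hf : IsLacunarySymbol N f) (i : Fin 2) (n : ℕ) :
    IsLacunarySymbol (N + n) ((_root_.partialDeriv i)^[n] f) := by
  induction n with
  | zero => exact hf
  | succ n ih =>
    rw [Function.iterate_succ_apply', ← add_assoc]
    exact ih.partialDeriv i

theorem multiDeriv (hf : IsLacunarySymbol N f) (α : Fin 2 → ℕ) :
    IsLacunarySymbol (N + α 1 + α 0) (multiDeriv α f) :=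
  (hf.iterate_partialDeriv 1 (α 1)).iterate_partialDeriv 0 (α 0)

theorem infDist_le (ξ : FreqPlane) : Metric.infDist ξ degenerateLine ≤ |ξ 0 + ξ 1| := by
  -- Moving along the first axis, rather than orthogonally to Γ, loses only a factor √2.
  have hmem : ξ - EuclideanSpace.single 0 (ξ 0 + ξ 1) ∈ degenerateLine := by
    simp [degenerateLine]
  refine (Metric.infDist_le_dist_of_mem hmem).trans ?_
  simp

theorem mem_multiplierClass (hf : IsLacunarySymbol 0 f) (M : ℕ) : f ∈ MultiplierClass M := by
  refine ⟨(hf.contDiff.of_le (by exact_mod_cast le_top)).contDiffOn, fun α _ => ?_⟩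
  obtain ⟨B, hB⟩ := (hf.multiDeriv α).bound
  refine ⟨B, fun ξ => le_trans ?_ (hB ξ)⟩
  rw [zero_add, add_comm (α 0)]
  gcongr
  · exact Metric.infDist_nonneg
  · exact infDist_le ξ

end IsLacunarySymbol

/-! ### Characters and Fourier inversion -/

/-- The character `t ↦ e^{2πit}`. -/
noncomputable def osc (t : ℝ) : ℂ := Complex.exp (((2 * Real.pi * t : ℝ) : ℂ) * Complex.I)

@[simp] theorem norm_osc (t : ℝ) : ‖osc t‖ = 1 := Complex.norm_exp_ofReal_mul_I _

theorem osc_add (s t : ℝ) : osc (s + t) = osc s * osc t := by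
  rw [osc, osc, osc, ← Complex.exp_add]
  congr 1
  push_cast
  ring

theorem contDiff_osc : ContDiff ℝ ∞ osc := by
  refine Complex.contDiff_exp.comp (ContDiff.mul ?_ contDiff_const)
  exact Complex.ofRealCLM.contDiff.comp (contDiff_const.mul contDiff_id)

@[fun_prop] theorem continuous_osc : Continuous osc := contDiff_osc.continuous

theorem fourier_eq_integral_osc (f : ℝ → ℂ) (ξ : ℝ) : 𝓕 f ξ = ∫ y, osc (-(y * ξ)) * f y := by
  rw [Real.fourier_real_eq_integral_exp_smul]
  refine integral_congr_ae (.of_forall fun y => ?_)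
  simp only [osc, smul_eq_mul]
  congr 4
  ring

theorem fourierInv_eq_integral_osc (f : ℝ → ℂ) (x : ℝ) : 𝓕⁻ f x = ∫ y, osc (y * x) * f y := by
  rw [Real.fourierInv_eq']
  refine integral_congr_ae (.of_forall fun y => ?_)
  have e : inner ℝ y x = y * x := by simp [mul_comm]
  simp only [osc, smul_eq_mul, e]

namespace SchwartzMap

theorem eq_integral_osc_fourier (a : 𝓢(ℝ, ℂ)) (x : ℝ) :
    a x = ∫ u, osc (u * x) * 𝓕 (a : ℝ → ℂ) u := by
  rw [← fourierInv_eq_integral_osc, ← SchwartzMap.fourier_coe, ← SchwartzMap.fourierInv_coe,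
    FourierPair.fourierInv_fourier_eq]

theorem eq_integral_osc_fourierInv (a : 𝓢(ℝ, ℂ)) (ξ : ℝ) :
    a ξ = ∫ y, osc (-(y * ξ)) * (𝓕⁻ a : 𝓢(ℝ, ℂ)) y := by
  rw [← fourier_eq_integral_osc, ← SchwartzMap.fourier_coe,
    FourierInvPair.fourier_fourierInv_eq]

theorem integrable_fourier (a : 𝓢(ℝ, ℂ)) : Integrable (𝓕 (a : ℝ → ℂ)) := by
  rw [← SchwartzMap.fourier_coe]
  exact SchwartzMap.integrable _

theorem continuous_fourier (a : 𝓢(ℝ, ℂ)) : Continuous (𝓕 (a : ℝ → ℂ)) := by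
  rw [← SchwartzMap.fourier_coe]
  exact SchwartzMap.continuous _

/-- The Fourier transform of a sum of modulated Schwartz functions. -/
theorem fourier_sum_osc_mul {ι : Type*} (s : Finset ι) (a : ι → 𝓢(ℝ, ℂ)) (N : ι → ℝ)
    {f : ℝ → ℂ} (hf : ∀ x, f x = ∑ i ∈ s, osc (N i * x) * a i x) (ξ : ℝ) :
    𝓕 f ξ = ∑ i ∈ s, 𝓕 (a i : ℝ → ℂ) (ξ - N i) := by
  simp_rw [fourier_eq_integral_osc, hf, Finset.mul_sum]
  rw [integral_finsetSum]
  · refine Finset.sum_congr rfl fun i _ => integral_congr_ae (.of_forall fun y => ?_)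
    simp only
    rw [← mul_assoc, ← osc_add]
    congr 2
    ring
  · intro i _
    refine (a i).integrable.norm.mono' (Continuous.aestronglyMeasurable ?_) (.of_forall ?_)
    · have := (a i).continuous
      fun_prop
    · simp

end SchwartzMap

/-! ### The operator on modulated packets -/

/-- The bilinear multiplier operator as an integral over `ℝ × ℝ`. -/
theorem bilinearMultiplier_eq_integral_prod (m : FreqPlane → ℂ) (f₁ f₂ : 𝓢(ℝ, ℂ)) (x : ℝ) :
    bilinearMultiplier m f₁ f₂ x = ∫ p : ℝ × ℝ, m !₂[p.1, p.2] * 𝓕 (f₁ : ℝ → ℂ) p.1 *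
      𝓕 (f₂ : ℝ → ℂ) p.2 * osc (x * (p.1 + p.2)) := by
  have h₁ := PiLp.volume_preserving_toLp (Fin 2)
  have h₂ := (volume_preserving_finTwoArrow ℝ).symm
  have e : ((fun p : ℝ × ℝ => (!₂[p.1, p.2] : FreqPlane))) =
      fun p => (MeasurableEquiv.toLp 2 (Fin 2 → ℝ)) (MeasurableEquiv.finTwoArrow.symm p) := by
    ext p i
    fin_cases i <;> rfl
  rw [bilinearMultiplier, ← h₁.integral_comp (MeasurableEquiv.toLp 2 (Fin 2 → ℝ)).measurableEmbedding,
    ← h₂.integral_comp MeasurableEquiv.finTwoArrow.symm.measurableEmbedding]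
  refine integral_congr_ae (.of_forall fun p => ?_)
  simp only [osc]
  have e' : WithLp.toLp 2 (MeasurableEquiv.finTwoArrow.symm p) = (!₂[p.1, p.2] : FreqPlane) := by
    ext i
    fin_cases i <;> rfl
  simp only [e', mul_assoc]
  simp

theorem continuous_toLp_pair : Continuous fun p : ℝ × ℝ => (!₂[p.1, p.2] : FreqPlane) := by
  refine (PiLp.continuous_toLp 2 _).comp (continuous_pi fun i => ?_)
  fin_cases i
  · exact continuous_fst
  · exact continuous_snd

section Bounded

variable {m : FreqPlane → ℂ} {B : ℝ}

theorem integrable_norm_fourier_prod (B : ℝ) (a b : 𝓢(ℝ, ℂ)) :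
    Integrable fun p : ℝ × ℝ => B * (‖𝓕 (a : ℝ → ℂ) p.1‖ * ‖𝓕 (b : ℝ → ℂ) p.2‖) :=
  (a.integrable_fourier.norm.mul_prod b.integrable_fourier.norm).const_mul B

theorem continuous_bilinearMultiplier (hm : Continuous m) (hB : ∀ ξ, ‖m ξ‖ ≤ B)
    (f₁ f₂ : 𝓢(ℝ, ℂ)) : Continuous (bilinearMultiplier m f₁ f₂) := by
  have c₁ := f₁.continuous_fourier
  have c₂ := f₂.continuous_fourier
  have cm := hm.comp continuous_toLp_pair
  simp only [Function.comp_def] at cm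
  simp_rw [funext (bilinearMultiplier_eq_integral_prod m f₁ f₂)]
  refine continuous_of_dominated (fun x => Continuous.aestronglyMeasurable (by fun_prop))
    (fun x => .of_forall fun p => ?_) (integrable_norm_fourier_prod B f₁ f₂)
    (.of_forall fun p => by fun_prop)
  rw [norm_mul, norm_osc, mul_one, norm_mul, norm_mul, mul_assoc]
  gcongr
  exact hB _

/-- The limit of a bilinear multiplier operator on sums of wave packets whose frequencies
`N L i` run off to infinity and decouple. -/
theorem tendsto_bilinearMultiplier {ι : Type*} [DecidableEq ι] (hm : Continuous m)
    (hB : ∀ ξ, ‖m ξ‖ ≤ B) (s : Finset ι) (a b : ι → 𝓢(ℝ, ℂ)) (N : ℕ → ι → ℝ)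
    (M : ι → ℝ → ℂ)
    (hM : ∀ i ∈ s, ∀ j ∈ s, ∀ u v : ℝ, Filter.Tendsto (fun L => m !₂[u + N L i, v - N L j])
      Filter.atTop (nhds (if i = j then M i (u + v) else 0)))
    {f₁ f₂ : ℕ → 𝓢(ℝ, ℂ)} (hf₁ : ∀ L x, f₁ L x = ∑ i ∈ s, osc (N L i * x) * a i x)
    (hf₂ : ∀ L x, f₂ L x = ∑ i ∈ s, osc (-N L i * x) * b i x) (x : ℝ) :
    Filter.Tendsto (fun L => bilinearMultiplier m (f₁ L) (f₂ L) x) Filter.atTop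
      (nhds (∑ i ∈ s, ∫ p : ℝ × ℝ, M i (p.1 + p.2) * 𝓕 (a i : ℝ → ℂ) p.1 *
        𝓕 (b i : ℝ → ℂ) p.2 * osc (x * (p.1 + p.2)))) := by
  have cm := hm.comp continuous_toLp_pair
  simp only [Function.comp_def] at cm
  have ca := fun i => (a i).continuous_fourier
  have cb := fun i => (b i).continuous_fourier
  -- The cross term (i, j), with both frequency variables recentred so that the dominating function
  -- does not depend on L.
  set K : ℕ → ι → ι → ℝ × ℝ → ℂ := fun L i j p => m !₂[p.1 + N L i, p.2 - N L j] *
    𝓕 (a i : ℝ → ℂ) p.1 * 𝓕 (b j : ℝ → ℂ) p.2 * osc (x * (p.1 + N L i + (p.2 - N L j)))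
  have hKbd : ∀ L i j p, ‖K L i j p‖ ≤
      B * (‖𝓕 (a i : ℝ → ℂ) p.1‖ * ‖𝓕 (b j : ℝ → ℂ) p.2‖) := by
    intro L i j p
    simp only [K]
    rw [norm_mul, norm_osc, mul_one, norm_mul, norm_mul, mul_assoc]
    gcongr
    exact hB _
  have hKm : ∀ L i j, AEStronglyMeasurable (K L i j) volume := by
    intro L i j
    refine Continuous.aestronglyMeasurable ?_
    have h1 := cm.comp (by fun_prop : Continuous fun p : ℝ × ℝ => (p.1 + N L i, p.2 - N L j))
    simp only [Function.comp_def] at h1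
    have h2 := ca i
    have h3 := cb j
    fun_prop
  have hT : ∀ L, bilinearMultiplier m (f₁ L) (f₂ L) x = ∑ i ∈ s, ∑ j ∈ s, ∫ p, K L i j p := by
    intro L
    have hint : ∀ i j, Integrable fun p : ℝ × ℝ => K L i j (p.1 - N L i, p.2 + N L j) := by
      intro i j
      have h0 : Integrable (K L i j) :=
        (integrable_norm_fourier_prod B (a i) (b j)).mono' (hKm L i j) (.of_forall (hKbd L i j))
      have := h0.comp_add_right (-N L i, N L j)
      refine this.congr (.of_forall fun p => ?_)
      simp [sub_eq_add_neg, Prod.add_def]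
    have htr : ∀ i j, ∫ p, K L i j p = ∫ p : ℝ × ℝ, K L i j (p.1 - N L i, p.2 + N L j) := by
      intro i j
      rw [← integral_add_right_eq_self (K L i j) (-N L i, N L j)]
      refine integral_congr_ae (.of_forall fun p => ?_)
      simp [sub_eq_add_neg, Prod.add_def]
    simp_rw [htr]
    rw [bilinearMultiplier_eq_integral_prod]
    simp_rw [← integral_finsetSum s fun j _ => hint _ j]
    rw [← integral_finsetSum s fun i _ => integrable_finsetSum s fun j _ => hint i j]
    refine integral_congr_ae (.of_forall fun p => ?_)
    simp only [K, SchwartzMap.fourier_sum_osc_mul s a (N L) (hf₁ L),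
      SchwartzMap.fourier_sum_osc_mul s b (fun i => -N L i) (hf₂ L), sub_neg_eq_add,
      sub_add_cancel, add_sub_cancel_right]
    simp only [Finset.mul_sum, Finset.sum_mul]
    exact Finset.sum_comm
  simp_rw [hT]
  have hlim : ∀ i ∈ s, ∀ j ∈ s, Filter.Tendsto (fun L => ∫ p, K L i j p) Filter.atTop
      (nhds (if i = j then ∫ p : ℝ × ℝ, M i (p.1 + p.2) * 𝓕 (a i : ℝ → ℂ) p.1 *
        𝓕 (b i : ℝ → ℂ) p.2 * osc (x * (p.1 + p.2)) else 0)) := by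
    intro i hi j hj
    have : (if i = j then ∫ p : ℝ × ℝ, M i (p.1 + p.2) * 𝓕 (a i : ℝ → ℂ) p.1 *
        𝓕 (b i : ℝ → ℂ) p.2 * osc (x * (p.1 + p.2)) else 0) =
        ∫ p : ℝ × ℝ, if i = j then M i (p.1 + p.2) * 𝓕 (a i : ℝ → ℂ) p.1 *
        𝓕 (b i : ℝ → ℂ) p.2 * osc (x * (p.1 + p.2)) else 0 := by
      split_ifs <;> simp
    rw [this]
    refine tendsto_integral_of_dominated_convergence _ (fun L => hKm L i j)
      (integrable_norm_fourier_prod B (a i) (b j)) (fun L => .of_forall (hKbd L i j))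
      (.of_forall fun p => ?_)
    have h := hM i hi j hj p.1 p.2
    by_cases hij : i = j
    · subst hij
      simp only [if_true] at h ⊢
      have e : ∀ L, x * (p.1 + N L i + (p.2 - N L i)) = x * (p.1 + p.2) := fun L => by ring
      simp only [K, e]
      exact ((h.mul_const _).mul_const _).mul_const _
    · simp only [hij, if_false] at h ⊢
      -- Off the diagonal the phase still oscillates with L, but it is unimodular, so only norms
      -- matter.
      rw [tendsto_zero_iff_norm_tendsto_zero] at h ⊢
      simp only [K, norm_mul, norm_osc, mul_one]
      simpa using (h.mul_const _).mul_const _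
  have := tendsto_finsetSum s fun i hi => tendsto_finsetSum s fun j hj => hlim i hi j hj
  refine this.trans_eq ?_
  congr 1
  refine Finset.sum_congr rfl fun i hi => ?_
  simp [hi]

end Bounded

/-- A bilinear multiplier depending on `ξ₁ + ξ₂` only is a convolution operator applied to the
product. -/
theorem integral_multiplier_add_eq (φ a b : 𝓢(ℝ, ℂ)) (r x : ℝ) :
    ∫ p : ℝ × ℝ, φ ((p.1 + p.2) / r) * 𝓕 (a : ℝ → ℂ) p.1 * 𝓕 (b : ℝ → ℂ) p.2 *
      osc (x * (p.1 + p.2)) =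
    ∫ y, (𝓕⁻ φ : 𝓢(ℝ, ℂ)) y * (a (x - y / r) * b (x - y / r)) := by
  set ψ : 𝓢(ℝ, ℂ) := 𝓕⁻ φ
  have ca := a.continuous_fourier
  have cb := b.continuous_fourier
  have cψ := ψ.continuous
  -- Writing φ as the Fourier transform of ψ splits the dependence on the two frequencies. After
  -- Fubini the inner integral is a product of two Fourier inversions at x - y/r.
  have h₁ : ∀ p : ℝ × ℝ, φ ((p.1 + p.2) / r) * 𝓕 (a : ℝ → ℂ) p.1 * 𝓕 (b : ℝ → ℂ) p.2 *
      osc (x * (p.1 + p.2)) = ∫ y, ψ y * (osc (p.1 * (x - y / r)) * 𝓕 (a : ℝ → ℂ) p.1 *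
        (osc (p.2 * (x - y / r)) * 𝓕 (b : ℝ → ℂ) p.2)) := by
    intro p
    rw [φ.eq_integral_osc_fourierInv, mul_assoc, mul_assoc, ← integral_mul_const]
    refine integral_congr_ae (.of_forall fun y => ?_)
    have e : osc (p.1 * (x - y / r)) * osc (p.2 * (x - y / r)) =
        osc (-(y * ((p.1 + p.2) / r))) * osc (x * (p.1 + p.2)) := by
      rw [← osc_add, ← osc_add]
      congr 1
      ring
    simp only
    linear_combination (-ψ y * 𝓕 (a : ℝ → ℂ) p.1 * 𝓕 (b : ℝ → ℂ) p.2) * e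
  simp_rw [h₁]
  rw [integral_integral_swap]
  · refine integral_congr_ae (.of_forall fun y => ?_)
    simp only
    rw [integral_const_mul, a.eq_integral_osc_fourier, b.eq_integral_osc_fourier]
    congr 1
    exact integral_prod_mul (fun u => osc (u * (x - y / r)) * 𝓕 (a : ℝ → ℂ) u)
      (fun v => osc (v * (x - y / r)) * 𝓕 (b : ℝ → ℂ) v)
  · have h₂ := (integrable_norm_fourier_prod 1 a b).mul_prod (ψ.integrable (μ := volume)).norm
    refine h₂.mono' (Continuous.aestronglyMeasurable (by fun_prop)) (.of_forall fun q => ?_)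
    simp only [Function.uncurry, norm_mul, norm_osc, one_mul]
    exact (mul_comm _ _).le

/-! ### Smooth windows and step approximation of characters -/

/-- A smooth bump supported in `[p, q + 1]` and equal to `1` on `[p + 1, q]`. -/
noncomputable def smoothWindow (p q x : ℝ) : ℝ :=
  Real.smoothTransition (x - p) - Real.smoothTransition (x - q)

section smoothWindow

variable {p q x : ℝ}

theorem smoothWindow_nonneg (h : p ≤ q) (x : ℝ) : 0 ≤ smoothWindow p q x :=
  sub_nonneg.2 (Real.smoothTransition.monotone (by linarith))

theorem smoothWindow_contDiff (p q : ℝ) : ContDiff ℝ ∞ (smoothWindow p q) :=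
  (Real.smoothTransition.contDiff.comp (contDiff_id.sub contDiff_const)).sub
    (Real.smoothTransition.contDiff.comp (contDiff_id.sub contDiff_const))

theorem smoothWindow_eq_zero_of_le (h : p ≤ q) (hx : x ≤ p) : smoothWindow p q x = 0 := by
  rw [smoothWindow, Real.smoothTransition.zero_of_nonpos (by linarith),
    Real.smoothTransition.zero_of_nonpos (by linarith), sub_zero]

theorem smoothWindow_eq_zero_of_ge (h : p ≤ q) (hx : q + 1 ≤ x) : smoothWindow p q x = 0 := by
  rw [smoothWindow, Real.smoothTransition.one_of_one_le (by linarith),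
    Real.smoothTransition.one_of_one_le (by linarith), sub_self]

theorem smoothWindow_eq_one (h₁ : p + 1 ≤ x) (h₂ : x ≤ q) : smoothWindow p q x = 1 := by
  rw [smoothWindow, Real.smoothTransition.one_of_one_le (by linarith),
    Real.smoothTransition.zero_of_nonpos (by linarith), sub_zero]

theorem mem_Icc_of_smoothWindow_ne_zero (h : p ≤ q) (hx : smoothWindow p q x ≠ 0) :
    x ∈ Set.Icc p (q + 1) := by
  by_contra hc
  rw [Set.mem_Icc, not_and_or, not_le, not_le] at hc
  rcases hc with hc | hc
  · exact hx (smoothWindow_eq_zero_of_le h hc.le)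
  · exact hx (smoothWindow_eq_zero_of_ge h hc.le)

theorem sum_smoothWindow_one (p y : ℝ) (J : ℕ) :
    ∑ j ∈ Finset.range J, smoothWindow p (p + 1) (y - j) =
      Real.smoothTransition (y - p) - Real.smoothTransition (y - p - J) := by
  have := Finset.sum_range_sub' (fun j : ℕ => Real.smoothTransition (y - p - j)) J
  simp only [Nat.cast_zero, sub_zero] at this
  rw [← this]
  refine Finset.sum_congr rfl fun j _ => ?_
  rw [smoothWindow]
  congr 2
  · ring
  · push_cast
    ring

theorem sum_smoothWindow_one_le (p y : ℝ) (J : ℕ) :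
    ∑ j ∈ Finset.range J, smoothWindow p (p + 1) (y - j) ≤ 1 := by
  rw [sum_smoothWindow_one]
  linarith [Real.smoothTransition.le_one (y - p), Real.smoothTransition.nonneg (y - p - J)]

theorem sum_smoothWindow_three_le (p y : ℝ) (J : ℕ) :
    ∑ j ∈ Finset.range J, smoothWindow p (p + 3) (y - j) ≤ 3 := by
  -- The wide window is the sum of three consecutive unit windows, each with translates summing to
  -- at most 1.
  have e : ∀ z, smoothWindow p (p + 3) z = smoothWindow p (p + 1) z +
      smoothWindow (p + 1) (p + 1 + 1) z + smoothWindow (p + 1 + 1) (p + 1 + 1 + 1) z := by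
    intro z
    simp only [smoothWindow]
    rw [show p + 1 + 1 + 1 = p + 3 by ring]
    ring
  simp_rw [e, Finset.sum_add_distrib]
  linarith [sum_smoothWindow_one_le p y J, sum_smoothWindow_one_le (p + 1) y J,
    sum_smoothWindow_one_le (p + 1 + 1) y J]

end smoothWindow

theorem norm_osc_sub_le (s t : ℝ) : ‖osc s - osc t‖ ≤ 2 * Real.pi * |s - t| := by
  have e : osc s - osc t = osc t * (osc (s - t) - 1) := by
    rw [mul_sub, ← osc_add, mul_one]
    congr 2
    ring
  rw [e, norm_mul, norm_osc, one_mul, osc, mul_comm _ Complex.I]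
  refine (Real.norm_exp_I_mul_ofReal_sub_one_le (x := 2 * Real.pi * (s - t))).trans_eq ?_
  rw [Real.norm_eq_abs, abs_mul, abs_of_pos Real.two_pi_pos]

/-- A step approximation of `osc (s * z)` on `(0, 1]`, subordinate to a smooth partition of
unity at scale `1 / J`. -/
noncomputable def oscStep (s : ℝ) (J : ℕ) (z : ℝ) : ℂ :=
  ∑ j ∈ Finset.range J, osc (s * (j / J)) * (smoothWindow 0 1 (J * z - j) : ℝ)

theorem continuous_oscStep (s : ℝ) (J : ℕ) : Continuous (oscStep s J) := by
  have := (smoothWindow_contDiff 0 1).continuous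
  unfold oscStep
  fun_prop

theorem sum_norm_smoothWindow_le (y : ℝ) (J : ℕ) :
    ∑ j ∈ Finset.range J, ‖((smoothWindow 0 1 (y - j) : ℝ) : ℂ)‖ ≤ 1 := by
  simp_rw [Complex.norm_real, Real.norm_eq_abs,
    abs_of_nonneg (smoothWindow_nonneg zero_le_one _)]
  simpa using sum_smoothWindow_one_le 0 y J

theorem norm_oscStep_le (s : ℝ) (J : ℕ) (z : ℝ) : ‖oscStep s J z‖ ≤ 1 := by
  refine (norm_sum_le _ _).trans ?_
  simp_rw [norm_mul, norm_osc, one_mul]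
  exact sum_norm_smoothWindow_le _ J

/-- Window j lives where 0 ≤ z - j/J ≤ 2/J, so replacing j/J by z in the phase costs O(1/J). The
weights telescope to a difference of two transitions, at Jz and at Jz - J. Both transitions vanish
at 0, which is why the limit interval is open at 0 and closed at 1. -/
theorem tendsto_oscStep (s z : ℝ) :
    Filter.Tendsto (fun J => oscStep s J z) Filter.atTop
      (nhds ((Set.Ioc (0 : ℝ) 1).indicator (fun z => osc (s * z)) z)) := by
  have hdiff : ∀ J : ℕ, 1 ≤ J → ‖oscStep s J z - osc (s * z) *
      ((∑ j ∈ Finset.range J, smoothWindow 0 1 (J * z - j) : ℝ) : ℂ)‖ ≤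
        (4 * Real.pi * |s|) / J := by
    intro J hJ
    have hJ0 : (0 : ℝ) < J := by exact_mod_cast hJ
    push_cast
    rw [oscStep, Finset.mul_sum, ← Finset.sum_sub_distrib]
    simp_rw [← sub_mul]
    refine (norm_sum_le _ _).trans ?_
    have hle : ∀ j ∈ Finset.range J, ‖(osc (s * (j / J)) - osc (s * z)) *
        ((smoothWindow 0 1 (J * z - j) : ℝ) : ℂ)‖ ≤
          (4 * Real.pi * |s|) / J * ‖((smoothWindow 0 1 (J * z - j) : ℝ) : ℂ)‖ := by
      intro j _
      by_cases h0 : smoothWindow 0 1 (J * z - j) = 0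
      · simp [h0]
      rw [norm_mul]
      gcongr
      have hm := mem_Icc_of_smoothWindow_ne_zero zero_le_one h0
      refine (norm_osc_sub_le _ _).trans ?_
      have e : s * (j / J) - s * z = -(s * (J * z - j) / J) := by field_simp; ring
      rw [e, abs_neg, abs_div, abs_mul, abs_of_pos hJ0, abs_of_nonneg hm.1, ← mul_div_assoc]
      gcongr ?_ / _
      have := hm.2
      have hp : 0 ≤ Real.pi * |s| := mul_nonneg Real.pi_pos.le (abs_nonneg s)
      nlinarith
    refine (Finset.sum_le_sum hle).trans ?_
    rw [← Finset.mul_sum]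
    exact mul_le_of_le_one_right (by positivity) (sum_norm_smoothWindow_le _ J)
  have hsum : ∀ J : ℕ, ∑ j ∈ Finset.range J, smoothWindow 0 1 (J * z - j) =
      Real.smoothTransition (J * z) - Real.smoothTransition (J * z - J) := by
    intro J
    simpa using sum_smoothWindow_one 0 (J * z) J
  have hzero : Filter.Tendsto (fun J => oscStep s J z - osc (s * z) *
      ((∑ j ∈ Finset.range J, smoothWindow 0 1 (J * z - j) : ℝ) : ℂ)) Filter.atTop (nhds 0) := by
    refine squeeze_zero_norm' ?_ (tendsto_const_div_atTop_nhds_zero_nat (4 * Real.pi * |s|))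
    filter_upwards [Filter.eventually_ge_atTop 1] with J hJ using hdiff J hJ
  have hmain : Filter.Tendsto (fun J : ℕ => osc (s * z) *
      ((∑ j ∈ Finset.range J, smoothWindow 0 1 (J * z - j) : ℝ) : ℂ)) Filter.atTop
        (nhds ((Set.Ioc (0 : ℝ) 1).indicator (fun z => osc (s * z)) z)) := by
    refine tendsto_const_nhds.congr' ?_
    by_cases hz : z ∈ Set.Ioc (0 : ℝ) 1
    · obtain ⟨J₀, hJ₀⟩ := exists_nat_ge (1 / z)
      filter_upwards [Filter.eventually_ge_atTop J₀] with J hJ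
      have hJz : 1 ≤ J * z := by
        rw [← div_le_iff₀ hz.1]
        exact hJ₀.trans (by exact_mod_cast hJ)
      have hJz' : (J : ℝ) * z - J ≤ 0 := by nlinarith [hz.2, (Nat.cast_nonneg J : (0 : ℝ) ≤ J)]
      rw [hsum, Set.indicator_of_mem hz, Real.smoothTransition.one_of_one_le hJz,
        Real.smoothTransition.zero_of_nonpos hJz']
      simp
    · rw [Set.indicator_of_notMem hz]
      rw [Set.mem_Ioc, not_and_or, not_lt, not_le] at hz
      rcases hz with hz | hz
      · refine .of_forall fun J => ?_
        have hJ := (Nat.cast_nonneg J : (0 : ℝ) ≤ J)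
        simp only
        rw [hsum, Real.smoothTransition.zero_of_nonpos (by nlinarith),
          Real.smoothTransition.zero_of_nonpos (by nlinarith)]
        simp
      · obtain ⟨J₀, hJ₀⟩ := exists_nat_ge (1 / (z - 1))
        filter_upwards [Filter.eventually_ge_atTop J₀] with J hJ
        have hJz : 1 ≤ J * z - J := by
          have : 1 ≤ J * (z - 1) := by
            rw [← div_le_iff₀ (by linarith)]
            exact hJ₀.trans (by exact_mod_cast hJ)
          linarith
        rw [hsum, Real.smoothTransition.one_of_one_le hJz,
          Real.smoothTransition.one_of_one_le (by linarith [(Nat.cast_nonneg J : (0 : ℝ) ≤ J)])]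
        simp
  simpa using hzero.add hmain

/-! ### Comparison with the lacunary sum -/

/-- The sum over `1 ≤ k ≤ n` of the convolutions of `F k` with the dilates of `ψ` to
scale `8 ^ (-k)`. -/
noncomputable def dilateSum (ψ : ℝ → ℂ) (n : ℕ) (F : ℕ → ℝ → ℂ) (x : ℝ) : ℂ :=
  ∑ k ∈ Finset.Icc 1 n, ∫ y, ψ y * F k (x - y / 8 ^ k)

theorem tendsto_dilateSum_oscStep (ψ : 𝓢(ℝ, ℂ)) (n : ℕ) (x : ℝ) :
    Filter.Tendsto (fun J => dilateSum ψ n (fun k => oscStep (8 ^ k) J) x) Filter.atTop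
      (nhds (dilateSum ψ n
        (fun k => (Set.Ioc (0 : ℝ) 1).indicator fun z => osc (8 ^ k * z)) x)) := by
  refine tendsto_finsetSum _ fun k _ => ?_
  refine tendsto_integral_of_dominated_convergence (fun y => ‖ψ y‖) (fun J => ?_)
    ψ.integrable.norm (fun J => .of_forall fun y => ?_) (.of_forall fun y => ?_)
  · have h₁ := continuous_oscStep (8 ^ k) J
    have h₂ := ψ.continuous
    exact Continuous.aestronglyMeasurable (by fun_prop)
  · rw [norm_mul]
    exact mul_le_of_le_one_right (norm_nonneg _) (norm_oscStep_le _ _ _)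
  · exact (tendsto_oscStep _ _).const_mul _

theorem sum_inv_eight_pow_le (n : ℕ) : ∑ k ∈ Finset.Icc 1 n, (1 / 8 : ℝ) ^ k ≤ 1 := by
  have h : ∑ k ∈ Finset.Icc 1 n, (1 / 8 : ℝ) ^ k ≤ 1 - (1 / 8) ^ n := by
    induction n with
    | zero => simp
    | succ n ih =>
      rw [Finset.sum_Icc_succ_top (by omega), pow_succ]
      have : (0 : ℝ) ≤ (1 / 8) ^ n := by positivity
      linarith
  have : (0 : ℝ) ≤ (1 / 8) ^ n := by positivity
  linarith

/-- Without the cutoff to (0, 1] each convolution would reproduce its character exactly. For x in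
[1/4, 3/4] the cutoff is felt only where |y| ≥ 8^k / 4, so one moment of ψ bounds the k-th error by
O(8^(-k)), which is summable. -/
theorem dilateSum_indicator_sub_le (φ : 𝓢(ℝ, ℂ)) (hφ : φ 1 = 1) :
    ∃ C : ℝ, 0 ≤ C ∧ ∀ n : ℕ, ∀ x ∈ Set.Icc (1 / 4 : ℝ) (3 / 4),
      ‖dilateSum (𝓕⁻ φ : 𝓢(ℝ, ℂ)) n
          (fun k => (Set.Ioc (0 : ℝ) 1).indicator fun z => osc (8 ^ k * z)) x -
        ∑ k ∈ Finset.Icc 1 n, osc (8 ^ k * x)‖ ≤ C := by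
  have hφ' := φ.eq_integral_osc_fourierInv 1
  set ψ : 𝓢(ℝ, ℂ) := 𝓕⁻ φ
  have hψ : Integrable fun y : ℝ => ‖y‖ ^ 1 * ‖ψ y‖ := ψ.integrable_pow_mul volume 1
  set K : ℝ := ∫ y : ℝ, ‖y‖ ^ 1 * ‖ψ y‖
  have hK : 0 ≤ K := integral_nonneg fun y => by positivity
  refine ⟨4 * K, by positivity, fun n x hx => ?_⟩
  have hterm : ∀ k ∈ Finset.Icc 1 n, ‖(∫ y, ψ y * (Set.Ioc (0 : ℝ) 1).indicator
      (fun z => osc (8 ^ k * z)) (x - y / 8 ^ k)) - osc (8 ^ k * x)‖ ≤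
        4 * K * (1 / 8) ^ k := by
    intro k _
    have h8 : (0 : ℝ) < 8 ^ k := by positivity
    -- The character of frequency 8^k is an eigenfunction of this convolution with eigenvalue φ(1) =
    -- 1.
    have e : osc (8 ^ k * x) = ∫ y, ψ y * osc (8 ^ k * (x - y / 8 ^ k)) := by
      rw [← mul_one (osc _), ← hφ, hφ', ← integral_const_mul]
      refine integral_congr_ae (.of_forall fun y => ?_)
      simp only
      rw [← mul_assoc, ← osc_add, mul_comm]
      congr 2
      field_simp
      ring
    have hi₂ : Integrable fun y => ψ y * osc (8 ^ k * (x - y / 8 ^ k)) := by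
      have h₂ := ψ.continuous
      refine ψ.integrable.norm.mono' (Continuous.aestronglyMeasurable (by fun_prop))
        (.of_forall fun y => by simp)
    have hi₁ : Integrable fun y => ψ y * (Set.Ioc (0 : ℝ) 1).indicator
        (fun z => osc (8 ^ k * z)) (x - y / 8 ^ k) := by
      refine ψ.integrable.norm.mono' ?_ (.of_forall fun y => ?_)
      · refine ψ.continuous.aestronglyMeasurable.mul (Measurable.aestronglyMeasurable ?_)
        have hm : Measurable ((Set.Ioc (0 : ℝ) 1).indicator fun z => osc (8 ^ k * z)) :=
          (Continuous.measurable (by fun_prop)).indicator measurableSet_Ioc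
        exact hm.comp (by fun_prop)
      · rw [norm_mul]
        refine mul_le_of_le_one_right (norm_nonneg _) ((norm_indicator_le_norm_self _ _).trans ?_)
        simp
    rw [e, ← integral_sub hi₁ hi₂]
    have hbd : ∀ y, ‖ψ y * (Set.Ioc (0 : ℝ) 1).indicator (fun z => osc (8 ^ k * z))
        (x - y / 8 ^ k) - ψ y * osc (8 ^ k * (x - y / 8 ^ k))‖ ≤
          4 * (1 / 8) ^ k * (‖y‖ ^ 1 * ‖ψ y‖) := by
      intro y
      rw [← mul_sub, norm_mul]
      by_cases hy : x - y / 8 ^ k ∈ Set.Ioc (0 : ℝ) 1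
      · rw [Set.indicator_of_mem hy, sub_self, norm_zero, mul_zero]
        positivity
      · rw [Set.indicator_of_notMem hy, zero_sub, norm_neg, norm_osc, mul_one]
        have hy' : 1 / 4 ≤ |y| / 8 ^ k := by
          by_contra hlt
          rw [not_le, ← abs_of_pos h8, ← abs_div, abs_lt] at hlt
          exact hy ⟨by linarith [hx.1, hx.2], by linarith [hx.1, hx.2]⟩
        have e2 : 4 * (1 / 8) ^ k * (‖y‖ ^ 1 * ‖ψ y‖) = (4 * (|y| / 8 ^ k)) * ‖ψ y‖ := by
          rw [one_div_pow, Real.norm_eq_abs]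
          ring
        rw [e2]
        exact le_mul_of_one_le_left (norm_nonneg _) (by linarith)
    refine (norm_integral_le_of_norm_le (hψ.const_mul _) (.of_forall hbd)).trans_eq ?_
    rw [integral_const_mul]
    ring
  rw [dilateSum, ← Finset.sum_sub_distrib]
  refine (norm_sum_le_of_le _ hterm).trans ?_
  rw [← Finset.mul_sum]
  exact mul_le_of_le_one_right (by positivity) (sum_inv_eight_pow_le n)

/-! ### Moments of lacunary exponential sums -/

theorem osc_intCast (n : ℤ) : osc n = 1 := by
  rw [osc, ← Complex.exp_int_mul_two_pi_mul_I n]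
  congr 1
  push_cast
  ring

theorem conj_osc (t : ℝ) : (starRingEnd ℂ) (osc t) = osc (-t) := by
  rw [osc, osc, ← Complex.exp_conj, map_mul, Complex.conj_ofReal, Complex.conj_I]
  congr 1
  push_cast
  ring

/-- At the endpoints 1/4 and 3/4 the phase takes the integer values 2q and 6q. Frequencies divisible
by 8 are thus orthogonal on this half-length interval too. -/
theorem integral_osc_eight_mul {q : ℤ} (hq : q ≠ 0) :
    ∫ x in (1 / 4 : ℝ)..(3 / 4), osc (8 * q * x) = 0 := by
  have hc : ((2 * Real.pi * (8 * q) : ℝ) : ℂ) * Complex.I ≠ 0 := by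
    refine mul_ne_zero (Complex.ofReal_ne_zero.2 ?_) Complex.I_ne_zero
    have : (q : ℝ) ≠ 0 := by exact_mod_cast hq
    have := Real.pi_ne_zero
    positivity
  have e : ∀ x : ℝ, osc (8 * q * x) = Complex.exp (((2 * Real.pi * (8 * q) : ℝ) : ℂ) *
      Complex.I * x) := by
    intro x
    rw [osc]
    congr 1
    push_cast
    ring
  simp_rw [e]
  rw [integral_exp_mul_complex hc, ← e, ← e]
  have e₁ : (8 * q * (3 / 4) : ℝ) = ((6 * q : ℤ) : ℝ) := by push_cast; ring
  have e₂ : (8 * q * (1 / 4) : ℝ) = ((2 * q : ℤ) : ℝ) := by push_cast; ring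
  rw [e₁, e₂, osc_intCast, osc_intCast, sub_self, zero_div]

/-- The lacunary sum `∑_{k=1}^n e^{2πi 8^k x}`. -/
noncomputable def lacunaryOsc (n : ℕ) (x : ℝ) : ℂ := ∑ k ∈ Finset.Icc 1 n, osc (8 ^ k * x)

@[fun_prop] theorem continuous_lacunaryOsc (n : ℕ) : Continuous (lacunaryOsc n) := by
  unfold lacunaryOsc
  fun_prop

theorem conj_lacunaryOsc (n : ℕ) (x : ℝ) :
    (starRingEnd ℂ) (lacunaryOsc n x) = ∑ k ∈ Finset.Icc 1 n, osc (-(8 ^ k * x)) := by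
  simp_rw [lacunaryOsc, map_sum, conj_osc]

theorem exists_eight_pow_eq {k : ℕ} (hk : 1 ≤ k) : ∃ q : ℤ, (8 : ℤ) ^ k = 8 * q :=
  dvd_pow_self 8 (by omega)

theorem integral_conj_lacunaryOsc_mul (n : ℕ) :
    ∫ x in (1 / 4 : ℝ)..(3 / 4), (starRingEnd ℂ) (lacunaryOsc n x) * osc (8 ^ (n + 1) * x) = 0 := by
  simp_rw [conj_lacunaryOsc, Finset.sum_mul, ← osc_add]
  rw [intervalIntegral.integral_finsetSum
    fun k _ => Continuous.intervalIntegrable (by fun_prop) _ _]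
  refine Finset.sum_eq_zero fun k hk => ?_
  rw [Finset.mem_Icc] at hk
  obtain ⟨q, hq⟩ := exists_eight_pow_eq hk.1
  have h1 : (8 : ℤ) ^ k < 8 ^ (n + 1) := pow_lt_pow_right₀ (by norm_num) (by omega)
  have hq' : (8 : ℝ) ^ k = 8 * q := by exact_mod_cast hq
  rw [← integral_osc_eight_mul (q := 8 ^ n - q) (by rw [pow_succ] at h1; omega)]
  refine intervalIntegral.integral_congr fun x _ => ?_
  congr 1
  rw [hq']
  push_cast
  ring

/-- Every frequency that occurs is 8^a - 8^b - 8^c + 8^(n+1) with b, c ≤ n. It is a multiple of 8,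
and it is positive because 8^b + 8^c ≤ 2 · 8^n. -/
theorem integral_lacunaryOsc_cubic_mul (n : ℕ) :
    ∫ x in (1 / 4 : ℝ)..(3 / 4), lacunaryOsc n x * (starRingEnd ℂ) (lacunaryOsc n x) *
      ((starRingEnd ℂ) (lacunaryOsc n x) * osc (8 ^ (n + 1) * x)) = 0 := by
  simp_rw [conj_lacunaryOsc]
  simp_rw [lacunaryOsc, Finset.sum_mul, Finset.mul_sum, Finset.sum_mul, ← osc_add]
  rw [intervalIntegral.integral_finsetSum
    fun k _ => Continuous.intervalIntegrable (by fun_prop) _ _]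
  refine Finset.sum_eq_zero fun a ha => ?_
  rw [intervalIntegral.integral_finsetSum
    fun k _ => Continuous.intervalIntegrable (by fun_prop) _ _]
  refine Finset.sum_eq_zero fun b hb => ?_
  rw [intervalIntegral.integral_finsetSum
    fun k _ => Continuous.intervalIntegrable (by fun_prop) _ _]
  refine Finset.sum_eq_zero fun c hc => ?_
  rw [Finset.mem_Icc] at ha hb hc
  obtain ⟨qa, hqa⟩ := exists_eight_pow_eq ha.1
  obtain ⟨qb, hqb⟩ := exists_eight_pow_eq hb.1
  obtain ⟨qc, hqc⟩ := exists_eight_pow_eq hc.1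
  have pa : (0 : ℤ) < 8 ^ a := by positivity
  have pn : (0 : ℤ) < 8 ^ n := by positivity
  have lb : (8 : ℤ) ^ b ≤ 8 ^ n := pow_le_pow_right₀ (by norm_num) hb.2
  have lc : (8 : ℤ) ^ c ≤ 8 ^ n := pow_le_pow_right₀ (by norm_num) hc.2
  have ea : (8 : ℝ) ^ a = 8 * qa := by exact_mod_cast hqa
  have eb : (8 : ℝ) ^ b = 8 * qb := by exact_mod_cast hqb
  have ec : (8 : ℝ) ^ c = 8 * qc := by exact_mod_cast hqc
  rw [← integral_osc_eight_mul (q := qa - qb - qc + 8 ^ n) (by omega)]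
  refine intervalIntegral.integral_congr fun x _ => ?_
  congr 1
  rw [ea, eb, ec]
  push_cast
  ring

theorem lacunaryOsc_succ (n : ℕ) (x : ℝ) :
    lacunaryOsc (n + 1) x = lacunaryOsc n x + osc (8 ^ (n + 1) * x) :=
  Finset.sum_Icc_succ_top (by omega) _

theorem norm_add_osc_sq (z : ℂ) (t : ℝ) :
    ‖z + osc t‖ ^ 2 = ‖z‖ ^ 2 + 1 + 2 * ((starRingEnd ℂ) z * osc t).re := by
  have h : ‖osc t‖ ^ 2 = 1 := by simp
  rw [← Complex.normSq_eq_norm_sq] at h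
  rw [← Complex.normSq_eq_norm_sq, ← Complex.normSq_eq_norm_sq, Complex.normSq_add, h]
  congr 2
  rw [← Complex.conj_re]
  simp [mul_comm]

theorem intervalIntegral_re_eq_zero {f : ℝ → ℂ} (hf : Continuous f) {a b : ℝ}
    (h : ∫ x in a..b, f x = 0) : ∫ x in a..b, (f x).re = 0 := by
  have := Complex.reCLM.intervalIntegral_comp_comm (hf.intervalIntegrable (μ := volume) a b)
  simpa [h] using this

theorem integral_re_conj_lacunaryOsc_mul (n : ℕ) :
    ∫ x in (1 / 4 : ℝ)..(3 / 4),
      ((starRingEnd ℂ) (lacunaryOsc n x) * osc (8 ^ (n + 1) * x)).re = 0 :=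
  intervalIntegral_re_eq_zero
    ((Complex.continuous_conj.comp (continuous_lacunaryOsc n)).mul (by fun_prop))
    (integral_conj_lacunaryOsc_mul n)

theorem integral_norm_sq_mul_re_conj_lacunaryOsc_mul (n : ℕ) :
    ∫ x in (1 / 4 : ℝ)..(3 / 4), ‖lacunaryOsc n x‖ ^ 2 *
      ((starRingEnd ℂ) (lacunaryOsc n x) * osc (8 ^ (n + 1) * x)).re = 0 := by
  have hc := Complex.continuous_conj.comp (continuous_lacunaryOsc n)
  simp only [Function.comp_def] at hc
  rw [← intervalIntegral_re_eq_zero (by fun_prop) (integral_lacunaryOsc_cubic_mul n)]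
  refine intervalIntegral.integral_congr fun x _ => ?_
  rw [Complex.mul_conj, Complex.re_ofReal_mul, Complex.normSq_eq_norm_sq]

theorem integral_norm_lacunaryOsc_sq (n : ℕ) :
    ∫ x in (1 / 4 : ℝ)..(3 / 4), ‖lacunaryOsc n x‖ ^ 2 = n / 2 := by
  induction n with
  | zero => simp [lacunaryOsc]
  | succ n ih =>
    have hc := Complex.continuous_conj.comp (continuous_lacunaryOsc n)
    simp only [Function.comp_def] at hc
    simp_rw [lacunaryOsc_succ, norm_add_osc_sq]
    rw [intervalIntegral.integral_add (Continuous.intervalIntegrable (by fun_prop) _ _)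
        (Continuous.intervalIntegrable (by fun_prop) _ _),
      intervalIntegral.integral_add (Continuous.intervalIntegrable (by fun_prop) _ _)
        (Continuous.intervalIntegrable (by fun_prop) _ _),
      intervalIntegral.integral_const_mul, integral_re_conj_lacunaryOsc_mul, ih,
      intervalIntegral.integral_const]
    push_cast
    norm_num
    ring

/-- Expand the fourth power after adding one term. The two cross terms linear in w integrate to zero
and 4w² is at most four times the squared norm. The increment is then at most 3n + 1/2, below 3/2 ·
((n+1)² - n²) = 3n + 3/2. -/
theorem integral_norm_lacunaryOsc_four_le (n : ℕ) :
    ∫ x in (1 / 4 : ℝ)..(3 / 4), ‖lacunaryOsc n x‖ ^ 4 ≤ 3 / 2 * n ^ 2 := by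
  induction n with
  | zero => simp [lacunaryOsc]
  | succ n ih =>
    have hc := Complex.continuous_conj.comp (continuous_lacunaryOsc n)
    simp only [Function.comp_def] at hc
    set w : ℝ → ℝ := fun x =>
      ((starRingEnd ℂ) (lacunaryOsc n x) * osc (8 ^ (n + 1) * x)).re with hw
    have cw : Continuous w := by fun_prop
    have hpt : ∀ x, ‖lacunaryOsc (n + 1) x‖ ^ 4 ≤
        ‖lacunaryOsc n x‖ ^ 4 + 6 * ‖lacunaryOsc n x‖ ^ 2 + 4 * (‖lacunaryOsc n x‖ ^ 2 * w x) +
          4 * w x + 1 := by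
      intro x
      have h₁ : ‖lacunaryOsc (n + 1) x‖ ^ 2 = ‖lacunaryOsc n x‖ ^ 2 + 1 + 2 * w x := by
        rw [lacunaryOsc_succ, norm_add_osc_sq]
      have h₂ : w x ^ 2 ≤ ‖lacunaryOsc n x‖ ^ 2 := by
        have h := Complex.abs_re_le_norm
          ((starRingEnd ℂ) (lacunaryOsc n x) * osc (8 ^ (n + 1) * x))
        rw [norm_mul, norm_osc, mul_one, Complex.norm_conj] at h
        exact sq_le_sq' (neg_le_of_abs_le h) (le_of_abs_le h)
      have e : ‖lacunaryOsc (n + 1) x‖ ^ 4 = (‖lacunaryOsc (n + 1) x‖ ^ 2) ^ 2 := by ring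
      rw [e, h₁]
      linarith
    have hmono := intervalIntegral.integral_mono (μ := volume) (by norm_num : (1 / 4 : ℝ) ≤ 3 / 4)
      (Continuous.intervalIntegrable (by fun_prop) _ _)
      (Continuous.intervalIntegrable (by fun_prop) _ _) hpt
    refine hmono.trans ?_
    rw [intervalIntegral.integral_add (Continuous.intervalIntegrable (by fun_prop) _ _)
        (Continuous.intervalIntegrable (by fun_prop) _ _),
      intervalIntegral.integral_add (Continuous.intervalIntegrable (by fun_prop) _ _)
        (Continuous.intervalIntegrable (by fun_prop) _ _),
      intervalIntegral.integral_add (Continuous.intervalIntegrable (by fun_prop) _ _)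
        (Continuous.intervalIntegrable (by fun_prop) _ _),
      intervalIntegral.integral_add (Continuous.intervalIntegrable (by fun_prop) _ _)
        (Continuous.intervalIntegrable (by fun_prop) _ _),
      intervalIntegral.integral_const_mul, intervalIntegral.integral_const_mul,
      intervalIntegral.integral_const_mul, integral_norm_lacunaryOsc_sq,
      integral_re_conj_lacunaryOsc_mul, integral_norm_sq_mul_re_conj_lacunaryOsc_mul,
      intervalIntegral.integral_const]
    push_cast
    norm_num
    linarith

/-- A pointwise form of interpolating L² between L^{1/2} and L⁴: the first term dominates when √t ≤
s, the second when √t ≥ s. -/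
theorem sq_le_sqrt_add_pow_four {t s : ℝ} (ht : 0 ≤ t) (hs : 0 < s) :
    t ^ 2 ≤ s ^ 3 * √t + t ^ 4 / s ^ 4 := by
  have hu := Real.sqrt_nonneg t
  have htu : t = √t ^ 2 := (Real.sq_sqrt ht).symm
  rcases le_total (√t) s with h | h
  · have h1 : √t ^ 3 ≤ s ^ 3 := pow_le_pow_left₀ hu h 3
    have h2 : t ^ 2 ≤ s ^ 3 * √t := by
      calc t ^ 2 = √t ^ 3 * √t := by nth_rewrite 1 [htu]; ring
        _ ≤ _ := by gcongr
    have : 0 ≤ t ^ 4 / s ^ 4 := by positivity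
    linarith
  · have h1 : s ^ 4 ≤ t ^ 2 := by
      calc s ^ 4 ≤ √t ^ 4 := pow_le_pow_left₀ hs.le h 4
        _ = t ^ 2 := by nth_rewrite 2 [htu]; ring
    have h2 : t ^ 2 ≤ t ^ 4 / s ^ 4 := by
      rw [le_div_iff₀ (by positivity)]
      calc t ^ 2 * s ^ 4 ≤ t ^ 2 * t ^ 2 := by gcongr
        _ = t ^ 4 := by ring
    have : 0 ≤ s ^ 3 * √t := by positivity
    linarith

/-- With n = 216q⁴ and s = 6q the L⁴ term is at most 54q⁴ = n/4, half of the L² integral n/2. The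
remaining 54q⁴ must come from s³ = 216q³ times the integral of the square root. -/
theorem le_four_mul_integral_sqrt_lacunaryOsc {q : ℕ} (hq : 0 < q) :
    (q : ℝ) ≤ 4 * ∫ x in (1 / 4 : ℝ)..(3 / 4), √‖lacunaryOsc (216 * q ^ 4) x‖ := by
  set n := 216 * q ^ 4 with hn
  have hq' : (0 : ℝ) < q := by exact_mod_cast hq
  have hmono := intervalIntegral.integral_mono (μ := volume) (by norm_num : (1 / 4 : ℝ) ≤ 3 / 4)
    (Continuous.intervalIntegrable (by fun_prop) _ _)
    (Continuous.intervalIntegrable (by fun_prop) _ _)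
    (fun x => sq_le_sqrt_add_pow_four (norm_nonneg (lacunaryOsc n x))
      (by positivity : (0 : ℝ) < 6 * q))
  rw [integral_norm_lacunaryOsc_sq, intervalIntegral.integral_add
    (Continuous.intervalIntegrable (by fun_prop) _ _)
    (Continuous.intervalIntegrable (by fun_prop) _ _), intervalIntegral.integral_const_mul,
    intervalIntegral.integral_div] at hmono
  set X := ∫ x in (1 / 4 : ℝ)..(3 / 4), √‖lacunaryOsc n x‖
  have h4 : (∫ x in (1 / 4 : ℝ)..(3 / 4), ‖lacunaryOsc n x‖ ^ 4) / (6 * q) ^ 4 ≤ 54 * q ^ 4 := by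
    rw [div_le_iff₀ (by positivity)]
    refine (integral_norm_lacunaryOsc_four_le n).trans_eq ?_
    rw [hn]
    push_cast
    ring
  have hnn : (n : ℝ) = 216 * q ^ 4 := by rw [hn]; push_cast; ring
  have h5 : (54 * q ^ 3 : ℝ) * q ≤ (54 * q ^ 3) * (4 * X) := by
    rw [hnn] at hmono
    nlinarith
  exact le_of_mul_le_mul_left h5 (by positivity)

theorem exists_lt_eLpNorm_lacunaryOsc {K : ℝ≥0∞} (hK : K ≠ ⊤) :
    ∃ n, K < eLpNorm (lacunaryOsc n) 2⁻¹ (volume.restrict (Set.Icc (1 / 4) (3 / 4))) := by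
  by_contra hcon
  push Not at hcon
  obtain ⟨q, hq⟩ := exists_nat_gt (4 * √K.toReal)
  have hq0 : 0 < q := by
    have : (0 : ℝ) < q := lt_of_le_of_lt (by positivity) hq
    exact_mod_cast this
  have hle := le_four_mul_integral_sqrt_lacunaryOsc hq0
  set G := lacunaryOsc (216 * q ^ 4) with hG
  have hGc : Continuous G := continuous_lacunaryOsc _
  have h := hcon (216 * q ^ 4)
  rw [eLpNorm_eq_lintegral_rpow_enorm_toReal (by simp) (by simp)] at h
  simp only [ENNReal.toReal_inv, ENNReal.toReal_ofNat, one_div, inv_inv] at h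
  have hint : ENNReal.ofReal (∫ x in (1 / 4 : ℝ)..(3 / 4), √‖G x‖) =
      ∫⁻ x in Set.Icc (1 / 4 : ℝ) (3 / 4), ‖G x‖ₑ ^ (2⁻¹ : ℝ) := by
    rw [intervalIntegral.integral_of_le (by norm_num), ← integral_Icc_eq_integral_Ioc,
      ofReal_integral_eq_lintegral_ofReal]
    · refine lintegral_congr fun x => ?_
      rw [Real.sqrt_eq_rpow, ← ENNReal.ofReal_rpow_of_nonneg (norm_nonneg _) (by norm_num),
        ofReal_norm, one_div]
    · exact Continuous.integrableOn_Icc (by fun_prop)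
    · exact .of_forall fun x => Real.sqrt_nonneg _
  norm_num at hint h
  rw [← hint] at h
  set X := ∫ x in (1 / 4 : ℝ)..(3 / 4), √‖G x‖
  have hX0 : 0 ≤ X := by
    have : (0 : ℝ) ≤ q := Nat.cast_nonneg q
    linarith
  rw [← ENNReal.ofReal_pow hX0, ENNReal.ofReal_le_iff_le_toReal hK] at h
  have := Real.le_sqrt_of_sq_le h
  linarith

/-! ### The phase coefficients and the limit of the symbol -/

theorem exists_isUnitBump : ∃ φ : ℝ → ℂ, IsUnitBump φ ∧ φ 1 = 1 := by
  let f : ContDiffBump (1 : ℝ) := ⟨1 / 4, 1 / 2, by norm_num, by norm_num⟩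
  refine ⟨fun x => (f x : ℂ), ⟨Complex.ofRealCLM.contDiff.comp f.contDiff, ?_⟩, ?_⟩
  · refine (tsupport_comp_subset (g := ((↑) : ℝ → ℂ)) Complex.ofReal_zero f).trans ?_
    rw [f.tsupport_eq, Real.closedBall_eq_Icc]
    norm_num [f]
  · have := f.one_of_mem_closedBall (Metric.mem_closedBall_self f.rIn_pos.le)
    simp [this]

/-- The coefficients of the counterexample: the index `t` encodes `n`, `j`, `J` (each triple is
encoded infinitely often) and carries the phases `e^{2πi 8^k j / J}`, `1 ≤ k ≤ n`. -/
noncomputable def phaseCoeff (t k : ℕ) : ℂ :=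
  if k ∈ Finset.Icc 1 t.unpair.1.unpair.1 then
    osc (8 ^ k * ((t.unpair.1.unpair.2.unpair.1 : ℝ) / (t.unpair.1.unpair.2.unpair.2 : ℝ)))
  else 0

/-- The `L`-th index encoding the triple `n`, `j`, `J`. -/
def phaseIndex (n J L j : ℕ) : ℕ := Nat.pair (Nat.pair n (Nat.pair j J)) L

theorem le_phaseIndex (n J L j : ℕ) : L ≤ phaseIndex n J L j := Nat.right_le_pair _ _

theorem phaseIndex_injective (n J L : ℕ) : Function.Injective (phaseIndex n J L) := by
  intro i j hij
  simp only [phaseIndex, Nat.pair_eq_pair, true_and, and_true] at hij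
  exact hij

theorem phaseCoeff_phaseIndex (n J L j k : ℕ) : phaseCoeff (phaseIndex n J L j) k =
    if k ∈ Finset.Icc 1 n then osc (8 ^ k * ((j : ℝ) / J)) else 0 := by
  simp [phaseCoeff, phaseIndex]

theorem isLacunarySymbol_phaseCoeff {φ : ℝ → ℂ} (hφ : IsUnitBump φ) :
    IsLacunarySymbol 0 (lacunarySum phaseCoeff φ φ) := by
  refine .lacunarySum (C := 1) hφ hφ fun t k _ => ?_
  rw [phaseCoeff]
  split_ifs <;> simp

theorem lacunarySum_eq_single {c : ℕ → ℕ → ℂ} {g h : ℝ → ℂ} (hg : IsUnitBump g) {ξ : FreqPlane}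
    {t : ℕ} (ht : g (ξ 0 / 8 ^ t) ≠ 0) : lacunarySum c g h ξ =
      ∑ k ∈ Finset.range (t + 1), c t k * g (ξ 0 / 8 ^ t) * h ((ξ 0 + ξ 1) / 8 ^ k) := by
  refine tsum_eq_single t fun u hu => Finset.sum_eq_zero fun k _ => ?_
  have : g (ξ 0 / 8 ^ u) = 0 := by
    by_contra hne
    exact hu (hg.scale_unique hne ht)
  rw [this, mul_zero, zero_mul]

theorem eight_pow_le_abs_sub {L a b : ℕ} (ha : L ≤ a) (hb : L ≤ b) (hab : a ≠ b) :
    (8 : ℝ) ^ L ≤ |8 ^ a - 8 ^ b| := by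
  wlog h : a < b generalizing a b
  · rw [abs_sub_comm]
    exact this hb ha hab.symm (by omega)
  have h₁ : (8 : ℝ) ^ L ≤ 8 ^ a := pow_le_pow_right₀ (by norm_num) ha
  have h₂ : (8 : ℝ) ^ (a + 1) ≤ 8 ^ b := pow_le_pow_right₀ (by norm_num) h
  rw [pow_succ] at h₂
  have h₃ : (0 : ℝ) < 8 ^ a := by positivity
  rw [abs_sub_comm]
  exact le_abs.2 (.inl (by linarith))

/-- The first frequency, close to 8^(t_i), selects block t_i with cutoff tending to φ(1) = 1. If i ≠
j, the sum of the frequencies is at least 8^L - |u + v| in size and leaves the support of every φ(·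
/ 8^k) with k ≤ n. -/
theorem tendsto_lacunarySum_phaseCoeff {φ : ℝ → ℂ} (hφ : IsUnitBump φ) (hφ1 : φ 1 = 1)
    (n J i j : ℕ) (u v : ℝ) :
    Filter.Tendsto (fun L => lacunarySum phaseCoeff φ φ
        !₂[u + 8 ^ phaseIndex n J L i, v - 8 ^ phaseIndex n J L j]) Filter.atTop
      (nhds (if i = j then
        ∑ k ∈ Finset.Icc 1 n, osc (8 ^ k * ((i : ℝ) / J)) * φ ((u + v) / 8 ^ k) else 0)) := by
  have hpow : Filter.Tendsto (fun L => (8 : ℝ) ^ phaseIndex n J L i) Filter.atTop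
      Filter.atTop :=
    (tendsto_pow_atTop_atTop_of_one_lt (by norm_num)).comp
      (Filter.tendsto_atTop_mono (fun L => le_phaseIndex n J L i) Filter.tendsto_id)
  have hφlim : Filter.Tendsto
      (fun L => φ ((u + 8 ^ phaseIndex n J L i) / 8 ^ phaseIndex n J L i)) Filter.atTop
      (nhds 1) := by
    have h₁ : Filter.Tendsto (fun L => u / 8 ^ phaseIndex n J L i + 1) Filter.atTop
        (nhds (0 + 1)) := (hpow.const_div_atTop u).add_const 1
    rw [zero_add] at h₁
    have h₂ := (hφ.smooth.continuous.tendsto 1).comp h₁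
    rw [hφ1] at h₂
    refine h₂.congr fun L => ?_
    simp only [Function.comp]
    congr 1
    field_simp
  have hne := hφlim.eventually_ne one_ne_zero
  have hval : ∀ᶠ L in Filter.atTop, lacunarySum phaseCoeff φ φ
      !₂[u + 8 ^ phaseIndex n J L i, v - 8 ^ phaseIndex n J L j] =
      φ ((u + 8 ^ phaseIndex n J L i) / 8 ^ phaseIndex n J L i) *
        ∑ k ∈ Finset.Icc 1 n, osc (8 ^ k * ((i : ℝ) / J)) *
          φ ((u + v + (8 ^ phaseIndex n J L i - 8 ^ phaseIndex n J L j)) / 8 ^ k) := by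
    filter_upwards [hne, Filter.eventually_ge_atTop n] with L hL hn
    -- Once n ≤ L ≤ t, the truncation k ≤ t removes none of the n active scales.
    have hsub : Finset.Icc 1 n ⊆ Finset.range (phaseIndex n J L i + 1) := by
      intro k hk
      rw [Finset.mem_Icc] at hk
      have := le_phaseIndex n J L i
      rw [Finset.mem_range]
      omega
    rw [lacunarySum_eq_single hφ (t := phaseIndex n J L i) (by simpa using hL), Finset.mul_sum,
      ← Finset.sum_subset hsub]
    · refine Finset.sum_congr rfl fun k hk => ?_
      rw [phaseCoeff_phaseIndex, if_pos hk]
      simp only [Matrix.cons_val_zero, Matrix.cons_val_one]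
      rw [mul_assoc, mul_left_comm]
      congr 4
      ring
    · intro k _ hk
      rw [phaseCoeff_phaseIndex, if_neg hk, zero_mul, zero_mul]
  refine Filter.Tendsto.congr' (hval.mono fun L hL => hL.symm) ?_
  by_cases hij : i = j
  · subst hij
    simpa using hφlim.mul_const
      (∑ k ∈ Finset.Icc 1 n, osc (8 ^ k * ((i : ℝ) / J)) * φ ((u + v) / 8 ^ k))
  · rw [if_neg hij]
    refine tendsto_const_nhds.congr' ?_
    have h8 : Filter.Tendsto (fun L : ℕ => (8 : ℝ) ^ L) Filter.atTop Filter.atTop :=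
      tendsto_pow_atTop_atTop_of_one_lt (by norm_num)
    filter_upwards [h8.eventually_gt_atTop (|u + v| + 3 / 2 * 8 ^ n)] with L hL
    rw [Finset.sum_eq_zero, mul_zero]
    intro k hk
    rw [Finset.mem_Icc] at hk
    have hsep := eight_pow_le_abs_sub (le_phaseIndex n J L i) (le_phaseIndex n J L j)
      ((phaseIndex_injective n J L).ne hij)
    set D : ℝ := 8 ^ phaseIndex n J L i - 8 ^ phaseIndex n J L j
    have hzero : φ ((u + v + D) / 8 ^ k) = 0 := by
      by_contra h0
      have hm := hφ.mem_Icc h0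
      have pk : (0 : ℝ) < 8 ^ k := by positivity
      have hkn : (8 : ℝ) ^ k ≤ 8 ^ n := pow_le_pow_right₀ (by norm_num) hk.2
      rw [Set.mem_Icc, div_le_iff₀ pk, le_div_iff₀ pk] at hm
      have h₁ : |u + v + D| ≤ 3 / 2 * 8 ^ k := abs_le.2 ⟨by linarith, hm.2⟩
      have h₂ := abs_sub (u + v + D) (u + v)
      rw [add_sub_cancel_left] at h₂
      linarith
    rw [hzero, mul_zero]

/-! ### Test functions and passage to the limit -/

theorem SchwartzMap.exists_coe_eq {F : ℝ → ℂ} (hF : ContDiff ℝ ∞ F) {l r : ℝ}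
    (h0 : ∀ x ∉ Set.Icc l r, F x = 0) : ∃ f : 𝓢(ℝ, ℂ), ⇑f = F :=
  ⟨(HasCompactSupport.intro isCompact_Icc h0).toSchwartzMap hF, rfl⟩

theorem eLpNorm_le_of_norm_le_of_support {F : ℝ → ℂ} {C : ℝ≥0} (hC : ∀ x, ‖F x‖ ≤ C)
    (h0 : ∀ x ∉ Set.Icc (-1 : ℝ) 3, F x = 0) {p : ℝ≥0∞} (hp : 1 ≤ p) :
    eLpNorm F p volume ≤ C * 4 := by
  have h₁ : ∀ x, ‖F x‖ ≤ ‖(Set.Icc (-1 : ℝ) 3).indicator (fun _ => (C : ℝ)) x‖ := by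
    intro x
    by_cases hx : x ∈ Set.Icc (-1 : ℝ) 3
    · rw [Set.indicator_of_mem hx]
      exact (hC x).trans (Real.le_norm_self _)
    · rw [h0 x hx, norm_zero]
      exact norm_nonneg _
  refine (eLpNorm_mono h₁).trans ((eLpNorm_indicator_const_le _ p).trans ?_)
  rw [Real.volume_Icc]
  have e : ENNReal.ofReal (3 - -1) = 4 := by norm_num
  rw [e]
  gcongr
  · simp [Real.enorm_eq_ofReal]
  · calc (4 : ℝ≥0∞) ^ (1 / p.toReal) ≤ 4 ^ (1 : ℝ) := by
          refine ENNReal.rpow_le_rpow_of_exponent_le (by norm_num) ?_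
          -- At `p = ⊤` the exponent 1 / `p.toReal` is 1 / 0 = 0.
          rcases eq_or_ne p ⊤ with rfl | hpt
          · simp
          · refine div_le_one_of_le₀ ?_ ENNReal.toReal_nonneg
            exact (ENNReal.ofReal_le_iff_le_toReal hpt).1 (by simpa using hp)
      _ = 4 := ENNReal.rpow_one 4

/-- Fatou's lemma, which remains available for exponents below 1. -/
theorem eLpNorm_le_of_tendsto {f : ℕ → ℝ → ℂ} {g : ℝ → ℂ} {p K : ℝ≥0∞}
    (hf : ∀ n, AEStronglyMeasurable (f n) volume)
    (hlim : ∀ x, Filter.Tendsto (fun n => f n x) Filter.atTop (nhds (g x)))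
    (hK : ∀ᶠ n in Filter.atTop, eLpNorm (f n) p volume ≤ K) : eLpNorm g p volume ≤ K :=
  (Lp.eLpNorm_lim_le_liminf_eLpNorm hf g (.of_forall hlim)).trans
    ((Filter.liminf_le_liminf hK).trans_eq (Filter.liminf_const K))

section wavePacket

variable {J : ℕ} {p q : ℝ}

/-- The `j`-th translate of a window at scale `1 / J`. -/
noncomputable def packet (p q : ℝ) (J j : ℕ) (x : ℝ) : ℂ := (smoothWindow p q (J * x - j) : ℝ)

theorem packet_contDiff (p q : ℝ) (J j : ℕ) : ContDiff ℝ ∞ (packet p q J j) :=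
  Complex.ofRealCLM.contDiff.comp ((smoothWindow_contDiff p q).comp
    ((contDiff_const.mul contDiff_id).sub contDiff_const))

theorem packet_eq_zero (hJ : 1 ≤ J) (hp : -1 ≤ p) (hpq : p ≤ q) (hq : q ≤ 2) {j : ℕ}
    (hj : j ∈ Finset.range J) {x : ℝ} (hx : x ∉ Set.Icc (-1 : ℝ) 3) : packet p q J j x = 0 := by
  rw [packet, Complex.ofReal_eq_zero]
  by_contra h0
  have hm := mem_Icc_of_smoothWindow_ne_zero hpq h0
  have hJ' : (1 : ℝ) ≤ J := by exact_mod_cast hJ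
  have hj' : (j : ℝ) + 1 ≤ J := by
    rw [Finset.mem_range] at hj
    exact_mod_cast hj
  have hj0 : (0 : ℝ) ≤ j := Nat.cast_nonneg j
  refine hx ⟨?_, ?_⟩
  · by_contra hlt
    nlinarith [hm.1]
  · by_contra hlt
    nlinarith [hm.2]

/-- The wide window equals 1 on [0, 2], which contains the support of the narrow one. The product of
paired packets is therefore again a packet of the partition of unity. -/
theorem packet_mul_packet (J j : ℕ) (x : ℝ) :
    packet 0 1 J j x * packet (-1) 2 J j x = packet 0 1 J j x := by
  by_cases h0 : smoothWindow 0 1 (J * x - j) = 0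
  · simp [packet, h0]
  · have hm := mem_Icc_of_smoothWindow_ne_zero zero_le_one h0
    rw [packet, packet, smoothWindow_eq_one (p := -1) (by linarith [hm.1]) (by linarith [hm.2])]
    simp

theorem norm_packet (hpq : p ≤ q) (j : ℕ) (x : ℝ) :
    ‖packet p q J j x‖ = smoothWindow p q (J * x - j) := by
  rw [packet, Complex.norm_real, Real.norm_eq_abs, abs_of_nonneg (smoothWindow_nonneg hpq _)]

/-- A superposition of the packets modulated to the frequencies `N j`. -/
theorem exists_schwartz_packet_sum (hJ : 1 ≤ J) (hp : -1 ≤ p) (hpq : p ≤ q) (hq : q ≤ 2)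
    (N : ℕ → ℝ) {C : ℝ≥0}
    (hC : ∀ y, ∑ j ∈ Finset.range J, smoothWindow p q (y - j) ≤ C) :
    ∃ f : 𝓢(ℝ, ℂ), (∀ x, f x = ∑ j ∈ Finset.range J, osc (N j * x) * packet p q J j x) ∧
      ∀ r : ℝ≥0∞, 1 ≤ r → eLpNorm f r volume ≤ C * 4 := by
  have h0 : ∀ x ∉ Set.Icc (-1 : ℝ) 3,
      ∑ j ∈ Finset.range J, osc (N j * x) * packet p q J j x = 0 := fun x hx =>
    Finset.sum_eq_zero fun j hj => by rw [packet_eq_zero hJ hp hpq hq hj hx, mul_zero]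
  obtain ⟨f, hf⟩ := SchwartzMap.exists_coe_eq (F := fun x =>
    ∑ j ∈ Finset.range J, osc (N j * x) * packet p q J j x)
    (ContDiff.sum fun j _ => (contDiff_osc.comp (contDiff_const.mul contDiff_id)).mul
      (packet_contDiff p q J j)) h0
  refine ⟨f, fun x => congrFun hf x, fun r hr => ?_⟩
  rw [hf]
  refine eLpNorm_le_of_norm_le_of_support (fun x => (norm_sum_le _ _).trans ?_) h0 hr
  simp_rw [norm_mul, norm_osc, one_mul, norm_packet hpq]
  exact hC _

end wavePacket

/-- The decoupled limit operator on packets, written as a sum of convolutions. -/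
theorem sum_integral_packet_eq_dilateSum (φ : 𝓢(ℝ, ℂ)) (n J : ℕ) {a b : ℕ → 𝓢(ℝ, ℂ)}
    (ha : ∀ j ∈ Finset.range J, ⇑(a j) = packet 0 1 J j)
    (hb : ∀ j ∈ Finset.range J, ⇑(b j) = packet (-1) 2 J j) (x : ℝ) :
    ∑ j ∈ Finset.range J, ∫ p : ℝ × ℝ,
      (∑ k ∈ Finset.Icc 1 n, osc (8 ^ k * ((j : ℝ) / J)) * φ ((p.1 + p.2) / 8 ^ k)) *
        𝓕 (a j : ℝ → ℂ) p.1 * 𝓕 (b j : ℝ → ℂ) p.2 * osc (x * (p.1 + p.2)) =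
    dilateSum (𝓕⁻ φ : 𝓢(ℝ, ℂ)) n (fun k => oscStep (8 ^ k) J) x := by
  set ψ : 𝓢(ℝ, ℂ) := 𝓕⁻ φ with hψ
  have cφ := φ.continuous
  have cψ := ψ.continuous
  have hleft : ∀ j ∈ Finset.range J, (∫ p : ℝ × ℝ,
      (∑ k ∈ Finset.Icc 1 n, osc (8 ^ k * ((j : ℝ) / J)) * φ ((p.1 + p.2) / 8 ^ k)) *
        𝓕 (a j : ℝ → ℂ) p.1 * 𝓕 (b j : ℝ → ℂ) p.2 * osc (x * (p.1 + p.2))) =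
      ∑ k ∈ Finset.Icc 1 n, osc (8 ^ k * ((j : ℝ) / J)) *
        ∫ y, ψ y * packet 0 1 J j (x - y / 8 ^ k) := by
    intro j hj
    have ca := (a j).continuous_fourier
    have cb := (b j).continuous_fourier
    obtain ⟨B, hB⟩ : ∃ B, ∀ y, ‖φ y‖ ≤ B := ⟨_, φ.toBoundedContinuousFunction.norm_coe_le_norm⟩
    simp_rw [Finset.sum_mul]
    rw [integral_finsetSum]
    · refine Finset.sum_congr rfl fun k _ => ?_
      have h := integral_multiplier_add_eq φ (a j) (b j) (8 ^ k) x
      rw [ha j hj, hb j hj] at h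
      simp_rw [packet_mul_packet] at h
      rw [← hψ] at h
      rw [← h, ← integral_const_mul, ha j hj, hb j hj]
      refine integral_congr_ae (.of_forall fun p => ?_)
      simp only
      ring
    · intro k _
      refine (integrable_norm_fourier_prod B (a j) (b j)).mono'
        (Continuous.aestronglyMeasurable (by fun_prop)) (.of_forall fun p => ?_)
      simp only [norm_mul, norm_osc, one_mul, mul_one]
      rw [mul_assoc]
      gcongr
      exact hB _
  rw [Finset.sum_congr rfl hleft, Finset.sum_comm, dilateSum]
  refine Finset.sum_congr rfl fun k _ => ?_
  simp_rw [oscStep, Finset.mul_sum]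
  rw [integral_finsetSum]
  · refine Finset.sum_congr rfl fun j _ => ?_
    rw [← integral_const_mul]
    refine integral_congr_ae (.of_forall fun y => ?_)
    simp only [packet]
    ring
  · intro j _
    have hs := (smoothWindow_contDiff 0 1).continuous
    refine ψ.integrable.norm.mono' (Continuous.aestronglyMeasurable (by fun_prop))
      (.of_forall fun y => ?_)
    rw [norm_mul, norm_mul, norm_osc, one_mul, Complex.norm_real, Real.norm_eq_abs,
      abs_of_nonneg (smoothWindow_nonneg zero_le_one _)]
    refine mul_le_of_le_one_right (norm_nonneg _) ?_
    rw [smoothWindow]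
    linarith [Real.smoothTransition.le_one ((J : ℝ) * (x - y / 8 ^ k) - j - 0),
      Real.smoothTransition.nonneg ((J : ℝ) * (x - y / 8 ^ k) - j - 1)]

/-- The inputs have sup norms at most 1 and 3 and live on an interval of length 4, whence the
factors 4 and 12, uniform in n, J and L. Sending L to infinity decouples the packets. -/
theorem eLpNorm_dilateSum_oscStep_le {φ : 𝓢(ℝ, ℂ)} (hφ : IsUnitBump φ) (hφ1 : φ 1 = 1)
    {p₁ p₂ : ℝ≥0∞} (hp₁ : 1 ≤ p₁) (hp₂ : 1 ≤ p₂) {C : ℝ≥0}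
    (hC : ∀ f₁ f₂ : 𝓢(ℝ, ℂ),
      eLpNorm (bilinearMultiplier (lacunarySum phaseCoeff φ φ) f₁ f₂) (p₁⁻¹ + p₂⁻¹)⁻¹ volume ≤
        (C : ℝ≥0∞) * eLpNorm (f₁ : ℝ → ℂ) p₁ volume * eLpNorm (f₂ : ℝ → ℂ) p₂ volume)
    (n : ℕ) {J : ℕ} (hJ : 1 ≤ J) :
    eLpNorm (dilateSum (𝓕⁻ φ : 𝓢(ℝ, ℂ)) n fun k => oscStep (8 ^ k) J) (p₁⁻¹ + p₂⁻¹)⁻¹ volume ≤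
      C * 4 * 12 := by
  have hsym := isLacunarySymbol_phaseCoeff hφ
  have hcont := hsym.contDiff.continuous
  obtain ⟨B, hB⟩ := hsym.bound
  simp only [pow_zero, one_mul] at hB
  have hex : ∀ (p q : ℝ), -1 ≤ p → p ≤ q → q ≤ 2 → ∃ a : ℕ → 𝓢(ℝ, ℂ),
      ∀ j ∈ Finset.range J, ⇑(a j) = packet p q J j := by
    intro p q hp hpq hq
    have : ∀ j, ∃ f : 𝓢(ℝ, ℂ), j ∈ Finset.range J → ⇑f = packet p q J j := by
      intro j
      by_cases hj : j ∈ Finset.range J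
      · obtain ⟨f, hf⟩ := SchwartzMap.exists_coe_eq (packet_contDiff p q J j)
          fun x hx => packet_eq_zero hJ hp hpq hq hj hx
        exact ⟨f, fun _ => hf⟩
      · exact ⟨0, fun h => (hj h).elim⟩
    choose a ha using this
    exact ⟨a, ha⟩
  obtain ⟨a, ha⟩ := hex 0 1 (by norm_num) (by norm_num) (by norm_num)
  obtain ⟨b, hb⟩ := hex (-1) 2 (by norm_num) (by norm_num) (by norm_num)
  choose f₁ hf₁ hn₁ using fun L => exists_schwartz_packet_sum (J := J) (p := 0) (q := 1) hJ
    (by norm_num) (by norm_num) (by norm_num) (fun j => 8 ^ phaseIndex n J L j) (C := 1)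
    (fun y => by simpa using sum_smoothWindow_one_le 0 y J)
  choose f₂ hf₂ hn₂ using fun L => exists_schwartz_packet_sum (J := J) (p := -1) (q := 2) hJ
    (by norm_num) (by norm_num) (by norm_num) (fun j => -8 ^ phaseIndex n J L j) (C := 3)
    (fun y => by
      have h := sum_smoothWindow_three_le (-1) y J
      norm_num at h
      exact h)
  refine eLpNorm_le_of_tendsto
    (f := fun L => bilinearMultiplier (lacunarySum phaseCoeff φ φ) (f₁ L) (f₂ L))
    (fun L => (continuous_bilinearMultiplier hcont hB _ _).aestronglyMeasurable) (fun x => ?_)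
    (.of_forall fun L => ?_)
  · rw [← sum_integral_packet_eq_dilateSum φ n J ha hb x]
    refine tendsto_bilinearMultiplier hcont hB (Finset.range J) a b
      (fun L j => 8 ^ phaseIndex n J L j)
      (fun j η => ∑ k ∈ Finset.Icc 1 n, osc (8 ^ k * ((j : ℝ) / J)) * φ (η / 8 ^ k))
      (fun i _ j _ u v => tendsto_lacunarySum_phaseCoeff hφ hφ1 n J i j u v) ?_ ?_ x
    · intro L x
      rw [hf₁]
      exact Finset.sum_congr rfl fun j hj => by rw [ha j hj]
    · intro L x
      rw [hf₂]
      exact Finset.sum_congr rfl fun j hj => by rw [hb j hj]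
  · refine (hC _ _).trans ?_
    have h₁ := hn₁ L p₁ hp₁
    have h₂ := hn₂ L p₂ hp₂
    norm_num at h₁ h₂
    gcongr

/-! ### Contradiction with an assumed estimate -/

theorem proposition2 :
    ∃ m : FreqPlane → ℂ, (∀ M : ℕ, m ∈ MultiplierClass M) ∧
      ∀ p₁ p₂ : ℝ≥0∞, 1 ≤ p₁ → 1 ≤ p₂ →
        ¬ SatisfiesLpEstimate (bilinearMultiplier m) p₁ p₂ := by
  obtain ⟨φ₀, hφ, hφ1⟩ := exists_isUnitBump
  obtain ⟨φ, rfl⟩ := SchwartzMap.exists_coe_eq hφ.smooth (l := 1 / 2) (r := 3 / 2)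
    fun x hx => by
      by_contra h0
      exact hx (hφ.mem_Icc h0)
  refine ⟨lacunarySum phaseCoeff φ φ, (isLacunarySymbol_phaseCoeff hφ).mem_multiplierClass, ?_⟩
  rintro p₁ p₂ hp₁ hp₂ ⟨C, hC⟩
  set r : ℝ≥0∞ := (p₁⁻¹ + p₂⁻¹)⁻¹
  -- The smallest exponent is 1/2, at p₁ = p₂ = 1, so disproving an L^{1/2} bound on a set of
  -- measure at most 1 settles all pairs at once.
  have hr : 2⁻¹ ≤ r := by
    refine ENNReal.inv_le_inv.2 ?_
    rw [← one_add_one_eq_two]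
    exact add_le_add (ENNReal.inv_le_one.2 hp₁) (ENNReal.inv_le_one.2 hp₂)
  set F : ℕ → ℝ → ℂ := fun n => dilateSum (𝓕⁻ φ : 𝓢(ℝ, ℂ)) n
    (fun k => (Set.Ioc (0 : ℝ) 1).indicator fun z => osc (8 ^ k * z))
  have hFm : ∀ n J, AEStronglyMeasurable
      (dilateSum (𝓕⁻ φ : 𝓢(ℝ, ℂ)) n fun k => oscStep (8 ^ k) J) volume := by
    intro n J
    refine Continuous.aestronglyMeasurable (continuous_finsetSum _ fun k _ => ?_)
    have cψ := (𝓕⁻ φ : 𝓢(ℝ, ℂ)).continuous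
    have co := continuous_oscStep (8 ^ k) J
    refine continuous_of_dominated (fun x => Continuous.aestronglyMeasurable (by fun_prop))
      (fun x => .of_forall fun y => ?_) (𝓕⁻ φ : 𝓢(ℝ, ℂ)).integrable.norm
      (.of_forall fun y => by fun_prop)
    rw [norm_mul]
    exact mul_le_of_le_one_right (norm_nonneg _) (norm_oscStep_le _ _ _)
  have hF : ∀ n, eLpNorm (F n) r volume ≤ C * 4 * 12 := fun n =>
    eLpNorm_le_of_tendsto (hFm n) (tendsto_dilateSum_oscStep _ n)
      (by filter_upwards [Filter.eventually_ge_atTop 1] with J hJ using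
        eLpNorm_dilateSum_oscStep_le hφ hφ1 hp₁ hp₂ hC n hJ)
  have hFmeas : ∀ n, AEStronglyMeasurable (F n) volume := fun n =>
    aestronglyMeasurable_of_tendsto_ae Filter.atTop (hFm n)
      (.of_forall (tendsto_dilateSum_oscStep _ n))
  obtain ⟨D, hD0, hD⟩ := dilateSum_indicator_sub_le φ hφ1
  set μ : Measure ℝ := volume.restrict (Set.Icc (1 / 4) (3 / 4))
  have hμ : μ Set.univ ≤ 1 := by
    simp only [μ, Measure.restrict_apply_univ, Real.volume_Icc]
    norm_num
  have hFhalf : ∀ n, eLpNorm (F n) 2⁻¹ μ ≤ C * 4 * 12 := by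
    intro n
    have h₁ := eLpNorm_le_eLpNorm_mul_rpow_measure_univ hr (hFmeas n).restrict (μ := μ)
    refine h₁.trans ((mul_le_of_le_one_right' ?_).trans
      ((eLpNorm_mono_measure _ Measure.restrict_le_self).trans (hF n)))
    refine ENNReal.rpow_le_one hμ (sub_nonneg.2 ?_)
    rcases eq_or_ne r ⊤ with h | h
    · simp [h]
    · refine one_div_le_one_div_of_le (by simp) (ENNReal.toReal_mono h hr)
  have hdiff : ∀ n, eLpNorm (fun x => lacunaryOsc n x - F n x) 2⁻¹ μ ≤ ENNReal.ofReal D := by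
    intro n
    have hae : ∀ᵐ x ∂μ, ‖lacunaryOsc n x - F n x‖ ≤ D := by
      refine (ae_restrict_iff' measurableSet_Icc).2 (.of_forall fun x hx => ?_)
      rw [norm_sub_rev]
      exact hD n x hx
    refine (eLpNorm_le_of_ae_bound hae).trans (mul_le_of_le_one_left' ?_)
    exact ENNReal.rpow_le_one hμ (by simp)
  -- L^{1/2} is only quasi-normed, so the triangle inequality carries a constant.
  set K : ℝ≥0∞ := ENNReal.LpAddConst 2⁻¹ * (C * 4 * 12 + ENNReal.ofReal D)
  have hK : K ≠ ⊤ := by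
    refine ENNReal.mul_ne_top (ENNReal.LpAddConst_lt_top _).ne (ENNReal.add_ne_top.2 ⟨?_, by simp⟩)
    exact ENNReal.mul_ne_top (ENNReal.mul_ne_top (by simp) (by simp)) (by simp)
  obtain ⟨n, hn⟩ := exists_lt_eLpNorm_lacunaryOsc hK
  refine hn.not_ge ?_
  have e : lacunaryOsc n = F n + fun x => lacunaryOsc n x - F n x := by
    ext x
    simp
  have hadd := eLpNorm_add_le' (hFmeas n).restrict (μ := μ)
    ((continuous_lacunaryOsc n).aestronglyMeasurable.sub (hFmeas n).restrict) 2⁻¹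
  rw [e]
  exact hadd.trans (mul_le_mul_right (add_le_add (hFhalf n) (hdiff n)) _)
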